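/- Let $\mathcal U=[0,1]$, let $\mathcal X\subset\mathbb R^d$ be compact and $\mathcal{UX}=\mathcal U\times\mathcal X$. Let $Q:\mathcal{UX}\to\mathbb R$, written $Q(u|x)$, be continuously differentiable, and suppose that the number of elements of $\{u\in\mathcal U:\partial_uQ(u|x)=0\}$ is bounded uniformly in $x\in\mathcal X$. For a curve $Q$ put $$F(y|x)=\int_0^1 1\{Q(u|x)\le y\}\,du,\qquad Q^*(u|x)=\inf\{y: F(y|x)\ge u\}.$$ Let $\mathcal Y_x$ be the support of the law of $Q(U|x)$ for $U$ uniform on $[0,1]$, and $\mathcal{YX}=\{(y,x):x\in\mathcal X,\ y\in\mathcal Y_x\}$. A number $y$ is a regular value of $Q(\cdot|x)$ if it is a value of $Q(\cdot|x)$ and $\partial_uQ(u|x)\neq0$ at each root $u\in[0,1]$ of $Q(u|x)=y$; the roots $u_1(y|x)<\dots<u_{K(y|x)}(y|x)$ are then finite in number. For continuous $h:\mathcal{UX}\to\mathbb R$ set, at regular values $y$, $$D_h(y|x)=-\sum_{k=1}^{K(y|x)}\frac{h(u_k(y|x)|x)}{|\partial_uQ(u_k(y|x)|x)|},\qquad f(y|x)=\sum_{k=1}^{K(y|x)}\frac1{|\partial_uQ(u_k(y|x)|x)|},$$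 and $D_h(y|x)=f(y|x)=0$ for all other $y\in\mathbb R$; set $\tilde D_h(u|x)=-D_h(Q^*(u|x)|x)/f(Q^*(u|x)|x)$ (with value $0$ where $Q^*(u|x)$ is not a regular value). For an index set $T$ let $\ell^\infty(T)$ be the space of bounded measurable real functions on $T$ with the supremum norm, and let $Z_n\Rightarrow Z$ in $\ell^\infty(T)$ mean convergence in law in the Hoffmann-Jørgensen sense: the $Z_n$ are (possibly non-measurable) maps into $\ell^\infty(T)$, $Z$ is a Borel measurable map into $\ell^\infty(T)$, and $E^*\varphi(Z_n)\to E\varphi(Z)$ for all bounded continuous $\varphi:\ell^\infty(T)\to\mathbb R$, where $E^*$ is outer expectation. Let $\widehat Q=\widehat Q_n$ be estimators with values in $\ell^\infty(\mathcal{UX})$, let $a_n\to\infty$, and suppose that $$a_n(\widehat Q-Q)\Rightarrow G\quad\text{in }\ell^\infty(\mathcal{UX}),$$ where $G$ is a process with continuous paths. Let $\widehat F$, $\widehat Q^*$ be obtained from $\widehat Q$ as $F$, $Q^*$ are from $Q$. For $\delta>0$ let $k_\delta(v)=1\{|v|\le\delta\}/(2\delta)$ and $$SF(y'|x)=\int_{\mathbb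 R}k_\delta(y'-y)F(y|x)\,dy,\qquad SQ^*(u'|x)=\int_{\mathcal U}k_\delta(u'-u)Q^*(u|x)\,du,$$ and similarly $S\widehat F$, $SD_G$ (integrals over $\mathbb R$) and $S\widehat Q^*$, $S\tilde D_G$ (integrals over $\mathcal U$). Then, for every fixed $\delta>0$, $$a_n(S\widehat F-SF)\Rightarrow SD_G\ \text{ in }\ell^\infty(\mathcal{YX}),\qquad a_n(S\widehat Q^*-SQ^*)\Rightarrow S\tilde D_G\ \text{ in }\ell^\infty(\mathcal{UX}).$$ Moreover, the results hold uniformly in the bandwidth: for all $0<\delta_1\le\delta_2$ the two convergences hold for the processes indexed also by $\delta\in[\delta_1,\delta_2]$, i.e. in $\ell^\infty(\mathcal{YX}\times[\delta_1,\delta_2])$ and in $\ell^\infty(\mathcal{UX}\times[\delta_1,\delta_2])$ respectively. -/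

import Mathlib

open MeasureTheory Set Filter Topology
open scoped ENNReal BoundedContinuousFunction

noncomputable section

namespace Rearrangement

/-- The space `ℝ^d` of covariates. -/
abbrev Cov (d : ℕ) : Type := EuclideanSpace ℝ (Fin d)

/-! ### Bounded measurable functions and convergence in law -/

/-- A real function on `T` that is bounded and measurable. -/
def IsBddMeas {T : Type*} [MeasurableSpace T] (f : T → ℝ) : Prop :=
  Measurable f ∧ ∃ C : ℝ, ∀ t, |f t| ≤ C

/-- The space `ℓ^∞(T)` of bounded measurable real functions on `T`, with the supremum distance. -/
abbrev EllInf (T : Type*) [MeasurableSpace T] : Type _ :=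
  {f : lp (fun _ : T => ℝ) ∞ // Measurable (fun t => f t)}

theorem IsBddMeas.memℓp {T : Type*} [MeasurableSpace T] {f : T → ℝ} (hf : IsBddMeas f) :
    Memℓp (E := fun _ : T => ℝ) f ∞ := by
  obtain ⟨C, hC⟩ := hf.2
  refine memℓp_infty ⟨C, ?_⟩
  rintro _ ⟨t, rfl⟩
  exact hC t

/-- A bounded measurable function as a point of `ℓ^∞(T)`. -/
def IsBddMeas.toEllInf {T : Type*} [MeasurableSpace T] {f : T → ℝ} (hf : IsBddMeas f) :
    EllInf T :=
  ⟨⟨f, hf.memℓp⟩, hf.1⟩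

/-- The outer expectation `E^* f` of a bounded, not necessarily measurable, `f : Ω → ℝ`: the infimum
of `E g` over the integrable measurable `g ≥ f`. -/
def outerExp {Ω : Type*} [MeasurableSpace Ω] (P : Measure Ω) (f : Ω → ℝ) : ℝ :=
  sInf {r : ℝ | ∃ g : Ω → ℝ, Measurable g ∧ Integrable g P ∧ (∀ ω, f ω ≤ g ω) ∧ r = ∫ ω, g ω ∂P}

/-- `Z_n ⇒ Z` in `ℓ^∞(T)` (convergence in law in the sense of Hoffmann-Jørgensen). All paths lie in
`ℓ^∞(T)`, the limit is a Borel measurable map into `ℓ^∞(T)`, the `Z_n` need not be measurable,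
and `E^* φ(Z_n) → E φ(Z)` for every bounded continuous `φ : ℓ^∞(T) → ℝ`. The `Z_n` may live on
different probability spaces. -/
structure ConvInLaw {T : Type*} [MeasurableSpace T]
    {Ω : ℕ → Type*} [∀ n, MeasurableSpace (Ω n)] (P : ∀ n, Measure (Ω n))
    {Ω' : Type*} [MeasurableSpace Ω'] (P' : Measure Ω')
    (Z : ∀ n, Ω n → T → ℝ) (Zlim : Ω' → T → ℝ) : Prop where
  mem : ∀ n ω, IsBddMeas (Z n ω)
  mem_lim : ∀ ω, IsBddMeas (Zlim ω)
  measurable_lim :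
    @Measurable Ω' (EllInf T) _ (borel (EllInf T)) (fun ω => (mem_lim ω).toEllInf)
  tendsto : ∀ φ : EllInf T →ᵇ ℝ,
    Tendsto (fun n => outerExp (P n) (fun ω => φ (mem n ω).toEllInf)) atTop
      (𝓝 (∫ ω, φ (mem_lim ω).toEllInf ∂P'))

/-! ### Curves. A curve `Q(u|x)` is a function `Q u x`; only its values at
`u ∈ [0,1]`, `x ∈ X` are ever used. -/

/-- `F(y|x) = ∫₀¹ 1{Q(u|x) ≤ y} du`. -/
def distr {d : ℕ} (Q : ℝ → Cov d → ℝ) (y : ℝ) (x : Cov d) : ℝ :=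
  ∫ u in Icc (0 : ℝ) 1, Set.indicator {u | Q u x ≤ y} (fun _ => (1 : ℝ)) u

/-- The rearranged curve `Q^*(u|x) = inf {y : F(y|x) ≥ u}`. (The value at the single point `u = 0`,
where the infimum is `-∞`, is immaterial: the rearranged curve only enters under integrals.) -/
def rearr {d : ℕ} (Q : ℝ → Cov d → ℝ) (u : ℝ) (x : Cov d) : ℝ :=
  sInf {y : ℝ | u ≤ distr Q y x}

/-- `∂_u Q(u|x)`, one-sided at the ends of `[0,1]`. -/
def partialU {d : ℕ} (Q : ℝ → Cov d → ℝ) (u : ℝ) (x : Cov d) : ℝ :=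
  derivWithin (fun v => Q v x) (Icc 0 1) u

/-- `Y_x`: the support of the law of `Q(U|x)`, where `U` is uniform on `[0,1]`. -/
def suppY {d : ℕ} (Q : ℝ → Cov d → ℝ) (x : Cov d) : Set ℝ :=
  (Measure.map (fun u => Q u x) (volume.restrict (Icc (0 : ℝ) 1))).support

/-- The region `YX = {(y,x) : x ∈ X, y ∈ Y_x}`. -/
def YX {d : ℕ} (Q : ℝ → Cov d → ℝ) (X : Set (Cov d)) : Set (ℝ × Cov d) :=
  {p | p.2 ∈ X ∧ p.1 ∈ suppY Q p.2}

/-- The region `UX = [0,1] × X`. -/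
def UX {d : ℕ} (X : Set (Cov d)) : Set (ℝ × Cov d) :=
  Icc (0 : ℝ) 1 ×ˢ X

/-- `{u ∈ [0,1] : Q(u|x) = y}`. -/
def rootSet {d : ℕ} (Q : ℝ → Cov d → ℝ) (y : ℝ) (x : Cov d) : Set ℝ :=
  {u | u ∈ Icc (0 : ℝ) 1 ∧ Q u x = y}

/-- `y` is a regular value of `u ↦ Q(u|x)`: it is a value, and `∂_u Q` vanishes at no root. -/
def IsRegularValue {d : ℕ} (Q : ℝ → Cov d → ℝ) (y : ℝ) (x : Cov d) : Prop :=
  (rootSet Q y x).Nonempty ∧ ∀ u ∈ rootSet Q y x, partialU Q u x ≠ 0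

open Classical in
/-- `f(y|x) = ∑_k 1 / |∂_u Q(u_k(y|x)|x)|` at regular values `y`, and `0` elsewhere. -/
def dens {d : ℕ} (Q : ℝ → Cov d → ℝ) (y : ℝ) (x : Cov d) : ℝ :=
  if IsRegularValue Q y x then ∑ᶠ u ∈ rootSet Q y x, 1 / |partialU Q u x| else 0

open Classical in
/-- `D_h(y|x) = - ∑_k h(u_k(y|x)|x) / |∂_u Q(u_k(y|x)|x)|` at regular values `y`, and `0` elsewhere
(for each `x`, only finitely many points of `Y_x` are not regular values). -/
def derivF {d : ℕ} (Q h : ℝ → Cov d → ℝ) (y : ℝ) (x : Cov d) : ℝ :=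
  if IsRegularValue Q y x then -∑ᶠ u ∈ rootSet Q y x, h u x / |partialU Q u x| else 0

/-- `D̃_h(u|x) = - D_h(Q^*(u|x)|x) / f(Q^*(u|x)|x)`. -/
def derivQ {d : ℕ} (Q h : ℝ → Cov d → ℝ) (u : ℝ) (x : Cov d) : ℝ :=
  -(1 / dens Q (rearr Q u x) x) * derivF Q h (rearr Q u x) x

/-! ### Smoothing -/

/-- The box kernel `k_δ(v) = 1{|v| ≤ δ} / (2δ)`. -/
def boxKernel (δ v : ℝ) : ℝ :=
  Set.indicator {v : ℝ | |v| ≤ δ} (fun _ => 1 / (2 * δ)) v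

/-- The smoothing `(S f)(z) = ∫ k_δ(z - y) f(y) dy` of a function `f` with domain `A ⊆ ℝ`. -/
def smooth (A : Set ℝ) (δ : ℝ) (f : ℝ → ℝ) (z : ℝ) : ℝ :=
  ∫ y in A, boxKernel δ (z - y) * f y

/-- `S g(y'|x)` for a curve `g(y|x)` with `y ∈ ℝ`, such as `F` and `D_h`. -/
def smoothY {d : ℕ} (δ : ℝ) (g : ℝ → Cov d → ℝ) (y' : ℝ) (x : Cov d) : ℝ :=
  smooth univ δ (fun y => g y x) y'

/-- `S g(u'|x)` for a curve `g(u|x)` with `u ∈ [0,1]`, such as `Q^*` and `D̃_h`. -/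
def smoothU {d : ℕ} (δ : ℝ) (g : ℝ → Cov d → ℝ) (u' : ℝ) (x : Cov d) : ℝ :=
  smooth (Icc 0 1) δ (fun u => g u x) u'

end Rearrangement

end

/-! Averaging removes the singularities that critical values of `Q` produce. Write `q = Q(·|x)`.
Smoothing the distribution function with a box kernel gives `(Φ(z + δ) - Φ(z - δ)) / (2δ)`, where
`Φ(y) = ∫ (y - q(u))₊ du` is `intCdf`. If `|r - q| ≤ ε`, then `Φ` changes by `-∫ 1{q ≤ y} (r - q)`
up to `ε` times the mass of the tube `{|q - y| ≤ ε}` (`BddCurve.abs_intCdf_sub_add_le`), since `(y -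
·)₊` is affine away from its kink.

The primitive of the quantile function is the Legendre conjugate of `Φ`: `∫₀ᵇ q^* = max_y (b y -
Φ(y))`, attained at `y = q^*(b)`. An envelope argument therefore transfers the expansion to `q^*`
(`BddCurve.abs_intQuant_sub_sub_le`).

Finitely many critical points make every level set finite, hence null, and compactness makes the
mass of thin tubes small uniformly in `x` and `y` (`exists_uniform_tube`). With `ε` of order `1 /
a_n`, the remainder multiplied by `a_n` is then uniformly negligible on bounded sets, while the
leading term is a continuous linear operator applied to `a_n (Q̂ - Q)`. The expansion holds for all
bounded measurable perturbations, so convergence in law follows from the continuous mapping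
principle with a vanishing error (`ConvInLaw.delta`). The error and the operator norm depend on `δ`
only through a positive lower bound, which yields uniformity in the bandwidth.

It remains to identify the limit. The operators are `-∫ k_δ(z - q(u)) h(u) du` and `∫ k_δ(z -
F(q(u))) h(u) du`. The area formula (`TameCurve.integral_rootSum`) turns them into the smoothings of
`D_h` and `D̃_h`; for the latter, `q^*` has the law of `q`, whose density is `f`. -/

noncomputable section

namespace Rearrangement

/-! ### Lipschitz regularisation of bounded continuous functions -/

section InfConv

variable {E : Type*} [PseudoMetricSpace E]

/-- The inf-convolution of `φ` with `k * dist`. -/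
def infConv (φ : E → ℝ) (k : ℝ) (w : E) : ℝ := ⨅ v, (φ v + k * dist w v)

variable {φ : E → ℝ} {C k : ℝ}

theorem infConv_bddBelow (hφ : ∀ v, |φ v| ≤ C) (hk : 0 ≤ k) (w : E) :
    BddBelow (range fun v => φ v + k * dist w v) := by
  refine ⟨-C, ?_⟩
  rintro _ ⟨v, rfl⟩
  have h1 := (abs_le.1 (hφ v)).1
  have h2 : 0 ≤ k * dist w v := by positivity
  simp only
  linarith

theorem infConv_le (hφ : ∀ v, |φ v| ≤ C) (hk : 0 ≤ k) (w : E) : infConv φ k w ≤ φ w := by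
  have := ciInf_le (infConv_bddBelow hφ hk w) w
  simpa [infConv] using this

theorem abs_infConv_le (hφ : ∀ v, |φ v| ≤ C) (hk : 0 ≤ k) (w : E) : |infConv φ k w| ≤ C := by
  have : Nonempty E := ⟨w⟩
  refine abs_le.2 ⟨le_ciInf fun v => ?_, (infConv_le hφ hk w).trans (abs_le.1 (hφ w)).2⟩
  have h1 := (abs_le.1 (hφ v)).1
  have h2 : 0 ≤ k * dist w v := by positivity
  linarith

theorem infConv_le_add (hφ : ∀ v, |φ v| ≤ C) (hk : 0 ≤ k) (w w' : E) :
    infConv φ k w ≤ infConv φ k w' + k * dist w w' := by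
  have : Nonempty E := ⟨w⟩
  rw [← sub_le_iff_le_add]
  refine le_ciInf fun v => ?_
  have h1 := ciInf_le (infConv_bddBelow hφ hk w) v
  have h2 : k * dist w v ≤ k * (dist w w' + dist w' v) :=
    mul_le_mul_of_nonneg_left (dist_triangle _ _ _) hk
  simp only [infConv] at h1 ⊢
  linarith

theorem abs_infConv_sub_le (hφ : ∀ v, |φ v| ≤ C) (hk : 0 ≤ k) (w w' : E) :
    |infConv φ k w - infConv φ k w'| ≤ k * dist w w' := by
  have h1 := infConv_le_add hφ hk w w'
  have h2 := infConv_le_add hφ hk w' w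
  rw [dist_comm] at h2
  exact abs_le.2 ⟨by linarith, by linarith⟩

/-- Points close to `w` lower the value by at most `ε / 2` by continuity; points at distance at
least `δ` pay a penalty `k δ ≥ 2C`, which exceeds the oscillation of `φ`. -/
theorem tendsto_infConv (hφ : ∀ v, |φ v| ≤ C) (hc : Continuous φ) (w : E) :
    Tendsto (fun k : ℕ => infConv φ k w) atTop (𝓝 (φ w)) := by
  have : Nonempty E := ⟨w⟩
  rw [Metric.tendsto_atTop]
  intro ε hε
  obtain ⟨δ, hδ, h⟩ := Metric.continuous_iff.1 hc w (ε / 2) (by positivity)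
  obtain ⟨N, hN⟩ := exists_nat_ge (2 * C / δ)
  refine ⟨N, fun k hk => ?_⟩
  have hle : φ w - ε / 2 ≤ infConv φ k w := by
    refine le_ciInf fun v => ?_
    rcases lt_or_ge (dist v w) δ with hv | hv
    · have h1 := h v hv
      rw [Real.dist_eq, abs_lt] at h1
      have : 0 ≤ (k : ℝ) * dist w v := by positivity
      linarith [h1.1]
    · have h1 := (abs_le.1 (hφ v)).1
      have h2 := (abs_le.1 (hφ w)).2
      have h3 : 2 * C / δ ≤ k := hN.trans (by exact_mod_cast hk)
      rw [div_le_iff₀ hδ] at h3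
      have h4 : (k : ℝ) * δ ≤ k * dist w v := by
        rw [dist_comm]
        gcongr
      linarith
  have hge := infConv_le hφ (Nat.cast_nonneg k) w
  rw [Real.dist_eq, abs_lt]
  constructor <;> linarith

/-- The inf-convolution as a bounded continuous function. -/
def infConvBCF (φ : E →ᵇ ℝ) (k : ℕ) : E →ᵇ ℝ :=
  BoundedContinuousFunction.ofNormedAddCommGroup (infConv φ k)
    (LipschitzWith.of_le_add_mul (k : NNReal) fun x y => by
      simpa using infConv_le_add (fun v => φ.norm_coe_le_norm v) (Nat.cast_nonneg k) x y).continuous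
    ‖φ‖ (fun w => abs_infConv_le (fun v => φ.norm_coe_le_norm v) (Nat.cast_nonneg k) w)

end InfConv

/-! ### Outer expectation -/

section OuterExp

variable {Ω : Type*} [MeasurableSpace Ω] {P : Measure Ω} [IsProbabilityMeasure P] {f g h : Ω → ℝ}
  {C : ℝ}

theorem outerExp_bddBelow (hf : ∀ ω, |f ω| ≤ C) :
    BddBelow {r : ℝ | ∃ g : Ω → ℝ, Measurable g ∧ Integrable g P ∧ (∀ ω, f ω ≤ g ω) ∧
      r = ∫ ω, g ω ∂P} := by
  refine ⟨-C, ?_⟩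
  rintro _ ⟨g, -, hg, hfg, rfl⟩
  have := integral_mono (μ := P) (integrable_const (-C)) hg
    (fun ω => (abs_le.1 (hf ω)).1.trans (hfg ω))
  simpa using this

theorem outerExp_nonempty (P : Measure Ω) [IsProbabilityMeasure P] (hf : ∀ ω, |f ω| ≤ C) :
    {r : ℝ | ∃ g : Ω → ℝ, Measurable g ∧ Integrable g P ∧ (∀ ω, f ω ≤ g ω) ∧
      r = ∫ ω, g ω ∂P}.Nonempty :=
  ⟨_, fun _ => C, measurable_const, integrable_const _, fun ω => (abs_le.1 (hf ω)).2, rfl⟩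

theorem outerExp_mono (hf : ∀ ω, |f ω| ≤ C) {C' : ℝ} (hg : ∀ ω, |g ω| ≤ C') (hfg : ∀ ω, f ω ≤ g ω) :
    outerExp P f ≤ outerExp P g := by
  refine csInf_le_csInf (outerExp_bddBelow hf) (outerExp_nonempty P hg) ?_
  rintro _ ⟨k, hk, hki, hgk, rfl⟩
  exact ⟨k, hk, hki, fun ω => (hfg ω).trans (hgk ω), rfl⟩

/-- Outer expectation is only subadditive: sums of measurable majorants are majorants. This
one-sided bound, used in both directions, replaces linearity. -/
theorem outerExp_le_add (hf : ∀ ω, |f ω| ≤ C) {C₁ C₂ : ℝ} (hg : ∀ ω, |g ω| ≤ C₁)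
    (hh : ∀ ω, |h ω| ≤ C₂) (c : ℝ) (hfg : ∀ ω, f ω ≤ g ω + h ω + c) :
    outerExp P f ≤ outerExp P g + outerExp P h + c := by
  rw [← sub_le_iff_le_add, ← sub_le_iff_le_add']
  refine le_csInf (outerExp_nonempty P hh) ?_
  rintro _ ⟨k, hk, hki, hhk, rfl⟩
  rw [sub_le_iff_le_add', ← sub_le_iff_le_add]
  refine le_csInf (outerExp_nonempty P hg) ?_
  rintro _ ⟨l, hl, hli, hgl, rfl⟩
  rw [sub_le_iff_le_add, sub_le_iff_le_add]
  refine csInf_le (outerExp_bddBelow hf) ⟨fun ω => l ω + k ω + c, (hl.add hk).add_const c,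
    (hli.add hki).add (integrable_const c), fun ω => ?_, ?_⟩
  · linarith [hfg ω, hhk ω, hgl ω]
  · have h1 := integral_add (hli.add hki) (integrable_const (μ := P) c)
    have h2 := integral_add hli hki
    simp only [Pi.add_apply, integral_const, probReal_univ, one_smul] at h1 h2
    rw [h1, h2]

end OuterExp

/-! ### The delta method -/

section Delta

theorem EllInf.dist_le {T : Type*} [MeasurableSpace T] {f g : EllInf T} {C : ℝ} (hC : 0 ≤ C)
    (h : ∀ t, |f.1 t - g.1 t| ≤ C) : dist f g ≤ C := by
  rw [Subtype.dist_eq, dist_eq_norm]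
  exact lp.norm_le_of_forall_le hC h

theorem EllInf.abs_sub_le {T : Type*} [MeasurableSpace T] (f g : EllInf T) (t : T) :
    |f.1 t - g.1 t| ≤ dist f g := by
  rw [Subtype.dist_eq, dist_eq_norm]
  exact lp.norm_apply_le_norm ENNReal.top_ne_zero (f.1 - g.1) t

theorem EllInf.abs_le {T : Type*} [MeasurableSpace T] (f : EllInf T) (t : T) :
    |f.1 t| ≤ ‖f.1‖ :=
  lp.norm_apply_le_norm ENNReal.top_ne_zero f.1 t

/-- A truncation of the norm: `0` on the ball of radius `M`, and `c` outside the ball of radius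
`M + 1`. -/
def normTail (T : Type*) [MeasurableSpace T] (c : ℝ) (M : ℕ) : EllInf T →ᵇ ℝ :=
  BoundedContinuousFunction.ofNormedAddCommGroup (fun z => c * min (max (‖z.1‖ - M) 0) 1)
    (by fun_prop) |c| (fun z => by
      rw [norm_mul, Real.norm_eq_abs, Real.norm_eq_abs]
      refine mul_le_of_le_one_right (abs_nonneg c) ?_
      rw [_root_.abs_of_nonneg (by positivity)]
      exact min_le_right _ _)

variable {T S : Type*} [MeasurableSpace T] [MeasurableSpace S]
  {Ω : ℕ → Type*} [∀ n, MeasurableSpace (Ω n)] {P : ∀ n, Measure (Ω n)}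
  {Ω' : Type*} [MeasurableSpace Ω'] {P' : Measure Ω'}
  {Z : ∀ n, Ω n → T → ℝ} {Zlim : Ω' → T → ℝ}

theorem ConvInLaw.measurable_comp (hZ : ConvInLaw P P' Z Zlim) {F : EllInf T → ℝ}
    (hF : Continuous F) : Measurable fun ω => F (hZ.mem_lim ω).toEllInf := by
  let _ : MeasurableSpace (EllInf T) := borel _
  have : BorelSpace (EllInf T) := ⟨rfl⟩
  exact hF.measurable.comp hZ.measurable_lim

variable [IsProbabilityMeasure P']

/-- Every path of the limit has finite norm, so the truncations vanish pointwise. Through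
convergence in law this bounds the tails of the norms of `Z n`. -/
theorem ConvInLaw.tendsto_integral_normTail (hZ : ConvInLaw P P' Z Zlim) (c : ℝ) :
    Tendsto (fun M : ℕ => ∫ ω, normTail T c M (hZ.mem_lim ω).toEllInf ∂P') atTop (𝓝 0) := by
  have h0 : (0 : ℝ) = ∫ _ω, (0 : ℝ) ∂P' := by simp
  rw [h0]
  refine tendsto_integral_of_dominated_convergence (fun _ => |c|)
    (fun M => (hZ.measurable_comp (normTail T c M).continuous).aestronglyMeasurable)
    (integrable_const _) (fun M => ae_of_all _ fun ω => ?_) (ae_of_all _ fun ω => ?_)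
  · change ‖c * min (max _ 0) 1‖ ≤ |c|
    rw [norm_mul, Real.norm_eq_abs, Real.norm_eq_abs]
    refine mul_le_of_le_one_right (abs_nonneg c) ?_
    rw [_root_.abs_of_nonneg (by positivity)]
    exact min_le_right _ _
  · obtain ⟨N, hN⟩ := exists_nat_ge ‖(hZ.mem_lim ω).toEllInf.1‖
    refine tendsto_const_nhds.congr' ?_
    filter_upwards [eventually_ge_atTop N] with M hM
    change 0 = c * min (max (_ - (M : ℝ)) 0) 1
    have : (N : ℝ) ≤ M := by exact_mod_cast hM
    rw [max_eq_right (by linarith)]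
    simp

variable [∀ n, IsProbabilityMeasure (P n)]

/-- Convergence of outer expectations of a Lipschitz function under an asymptotically negligible
perturbation of a continuous image. -/
theorem ConvInLaw.tendsto_outerExp_of_lipschitz (hZ : ConvInLaw P P' Z Zlim)
    {Lm : EllInf T → EllInf S} (hL : Continuous Lm)
    {W : ∀ n, Ω n → S → ℝ} (hW : ∀ n ω, IsBddMeas (W n ω))
    (happ : ∀ M : ℝ, ∀ η > 0, ∀ᶠ n in atTop, ∀ ω, (∀ t, |Z n ω t| ≤ M) →
      ∀ s, |W n ω s - (Lm (hZ.mem n ω).toEllInf).1 s| ≤ η)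
    (ψ : EllInf S →ᵇ ℝ) {k : ℝ} (hk : 0 ≤ k) (hψ : ∀ v w, |ψ v - ψ w| ≤ k * dist v w) :
    Tendsto (fun n => outerExp (P n) (fun ω => ψ (hW n ω).toEllInf)) atTop
      (𝓝 (∫ ω, ψ (Lm (hZ.mem_lim ω).toEllInf) ∂P')) := by
  have hT := hZ.tendsto (ψ.compContinuous ⟨Lm, hL⟩)
  rw [Metric.tendsto_atTop] at hT ⊢
  intro ε hε
  have hψb : ∀ v, |ψ v| ≤ ‖ψ‖ := fun v => ψ.norm_coe_le_norm v
  -- `c` bounds the oscillation of `ψ`, so `normTail T c M` dominates the error wherever the norm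
  -- exceeds `M + 1`.
  set c : ℝ := 2 * ‖ψ‖ with hc
  obtain ⟨M, hM⟩ := ((hZ.tendsto_integral_normTail c).eventually_lt_const
    (show (0 : ℝ) < ε / 8 by positivity)).exists
  obtain ⟨N₁, hN₁⟩ := hT (ε / 4) (by positivity)
  obtain ⟨N₂, hN₂⟩ := eventually_atTop.1 <| (hZ.tendsto (normTail T c M)).eventually_lt_const
    (show _ < ε / 4 by linarith)
  -- Dividing by `k + 1` makes the Lipschitz error at most `ε / 4` and stays legitimate for `k = 0`.
  obtain ⟨N₃, hN₃⟩ := eventually_atTop.1 <| happ (M + 1) (ε / 4 / (k + 1)) (by positivity)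
  refine ⟨max N₁ (max N₂ N₃), fun n hn => ?_⟩
  have h1 := hN₁ n (le_of_max_le_left hn)
  have h2 := hN₂ n (le_of_max_le_left (le_of_max_le_right hn))
  have h3 := hN₃ n (le_of_max_le_right (le_of_max_le_right hn))
  have key : ∀ ω, |ψ (hW n ω).toEllInf - ψ (Lm (hZ.mem n ω).toEllInf)| ≤
      normTail T c M (hZ.mem n ω).toEllInf + ε / 4 := by
    intro ω
    have hnn : 0 ≤ normTail T c M (hZ.mem n ω).toEllInf := by
      change 0 ≤ c * min (max _ 0) 1
      positivity
    rcases le_or_gt ‖(hZ.mem n ω).toEllInf.1‖ (M + 1) with hle | hgt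
    · have h4 := h3 ω (fun t => ((hZ.mem n ω).toEllInf.abs_le t).trans hle)
      have h5 : dist (hW n ω).toEllInf (Lm (hZ.mem n ω).toEllInf) ≤ ε / 4 / (k + 1) :=
        EllInf.dist_le (by positivity) h4
      have h6 := hψ (hW n ω).toEllInf (Lm (hZ.mem n ω).toEllInf)
      have h7 : k * dist (hW n ω).toEllInf (Lm (hZ.mem n ω).toEllInf) ≤ ε / 4 := by
        calc _ ≤ (k + 1) * (ε / 4 / (k + 1)) := by gcongr; linarith
          _ = ε / 4 := by field_simp
      linarith
    · have h8 : normTail T c M (hZ.mem n ω).toEllInf = c := by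
        change c * min (max (_ - (M : ℝ)) 0) 1 = c
        rw [min_eq_right, mul_one]
        exact le_max_of_le_left (by linarith)
      have h9 := abs_sub (ψ (hW n ω).toEllInf) (ψ (Lm (hZ.mem n ω).toEllInf))
      have h10 := hψb (hW n ω).toEllInf
      have h11 := hψb (Lm (hZ.mem n ω).toEllInf)
      rw [h8]
      linarith
  have hup := outerExp_le_add (P := P n) (fun ω => hψb (hW n ω).toEllInf)
    (fun ω => hψb (Lm (hZ.mem n ω).toEllInf))
    (fun ω => (normTail T c M).norm_coe_le_norm (hZ.mem n ω).toEllInf) (ε / 4)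
    (fun ω => by linarith [(_root_.abs_le.1 (key ω)).2])
  have hlo := outerExp_le_add (P := P n) (fun ω => hψb (Lm (hZ.mem n ω).toEllInf))
    (fun ω => hψb (hW n ω).toEllInf)
    (fun ω => (normTail T c M).norm_coe_le_norm (hZ.mem n ω).toEllInf) (ε / 4)
    (fun ω => by linarith [(_root_.abs_le.1 (key ω)).1])
  simp only [BoundedContinuousFunction.compContinuous_apply, ContinuousMap.coe_mk] at h1
  rw [Real.dist_eq, abs_lt] at h1 ⊢
  constructor <;> linarith [h1.1, h1.2]

/-- The delta method: a sequence that differs from a continuous image of a sequence converging in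
law by a remainder that is uniformly small on bounded sets converges to the image of the limit. -/
theorem ConvInLaw.delta (hZ : ConvInLaw P P' Z Zlim)
    {Lm : EllInf T → EllInf S} (hL : Continuous Lm)
    {W : ∀ n, Ω n → S → ℝ} (hW : ∀ n ω, IsBddMeas (W n ω)) {Wlim : Ω' → S → ℝ}
    (hlim : ∀ ω s, Wlim ω s = (Lm (hZ.mem_lim ω).toEllInf).1 s)
    (happ : ∀ M : ℝ, ∀ η > 0, ∀ᶠ n in atTop, ∀ ω, (∀ t, |Z n ω t| ≤ M) →
      ∀ s, |W n ω s - (Lm (hZ.mem n ω).toEllInf).1 s| ≤ η) :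
    ConvInLaw P P' W Wlim := by
  have hmem : ∀ ω, IsBddMeas (Wlim ω) := fun ω => by
    have : Wlim ω = (Lm (hZ.mem_lim ω).toEllInf).1 := funext (hlim ω)
    rw [this]
    exact ⟨(Lm (hZ.mem_lim ω).toEllInf).2, _, (Lm (hZ.mem_lim ω).toEllInf).abs_le⟩
  have hto : ∀ ω, (hmem ω).toEllInf = Lm (hZ.mem_lim ω).toEllInf := fun ω =>
    Subtype.ext (lp.ext (funext (hlim ω)))
  refine ⟨hW, hmem, ?_, fun φ => ?_⟩
  · simp only [hto]
    let _ : MeasurableSpace (EllInf T) := borel _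
    have : BorelSpace (EllInf T) := ⟨rfl⟩
    let _ : MeasurableSpace (EllInf S) := borel _
    have : BorelSpace (EllInf S) := ⟨rfl⟩
    exact hL.measurable.comp hZ.measurable_lim
  · simp only [hto]
    -- Approximation from below by Lipschitz functions is enough: outer expectation is monotone, so
    -- `φ` gives the lower bound and `-φ` the upper one.
    have lower : ∀ (φ : EllInf S →ᵇ ℝ) (ε : ℝ), 0 < ε → ∃ (ψ : EllInf S →ᵇ ℝ) (k : ℝ), 0 ≤ k ∧
        (∀ v w, |ψ v - ψ w| ≤ k * dist v w) ∧ (∀ v, ψ v ≤ φ v) ∧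
        ∫ ω, φ (Lm (hZ.mem_lim ω).toEllInf) ∂P' - ε < ∫ ω, ψ (Lm (hZ.mem_lim ω).toEllInf) ∂P' := by
      intro φ ε hε
      have hb : ∀ v, |φ v| ≤ ‖φ‖ := fun v => φ.norm_coe_le_norm v
      have ht : Tendsto (fun k : ℕ => ∫ ω, infConvBCF φ k (Lm (hZ.mem_lim ω).toEllInf) ∂P') atTop
          (𝓝 (∫ ω, φ (Lm (hZ.mem_lim ω).toEllInf) ∂P')) := by
        refine tendsto_integral_of_dominated_convergence (fun _ => ‖φ‖)
          (fun k => (hZ.measurable_comp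
            ((infConvBCF φ k).continuous.comp hL)).aestronglyMeasurable)
          (integrable_const _)
          (fun k => ae_of_all _ fun ω => abs_infConv_le hb (Nat.cast_nonneg k) _)
          (ae_of_all _ fun ω => tendsto_infConv hb φ.continuous _)
      obtain ⟨k, hk⟩ := (ht.eventually_const_lt
        (show ∫ ω, φ (Lm (hZ.mem_lim ω).toEllInf) ∂P' - ε < _ by linarith)).exists
      exact ⟨infConvBCF φ k, k, Nat.cast_nonneg k, abs_infConv_sub_le hb (Nat.cast_nonneg k),
        infConv_le hb (Nat.cast_nonneg k), hk⟩
    have hb : ∀ (φ : EllInf S →ᵇ ℝ) v, |φ v| ≤ ‖φ‖ := fun φ v => φ.norm_coe_le_norm v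
    refine tendsto_order.2 ⟨fun a ha => ?_, fun a ha => ?_⟩
    · obtain ⟨ψ, k, hk, hlip, hle, hint⟩ := lower φ _ (sub_pos.2 ha)
      rw [sub_sub_cancel] at hint
      filter_upwards [(hZ.tendsto_outerExp_of_lipschitz hL hW happ ψ hk hlip).eventually_const_lt
        hint] with n hn
      exact hn.trans_le (outerExp_mono (fun ω => hb ψ _) (fun ω => hb φ _) fun ω => hle _)
    -- Outer expectation is not odd, so the convergence is applied to the Lipschitz majorant `-ψ` of
    -- `φ` and not to `ψ`.
    · obtain ⟨ψ, k, hk, hlip, hle, hint⟩ := lower (-φ) _ (sub_pos.2 ha)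
      simp only [BoundedContinuousFunction.coe_neg, Pi.neg_apply, integral_neg] at hint hle
      have hint' : ∫ ω, (-ψ) (Lm (hZ.mem_lim ω).toEllInf) ∂P' < a := by
        simp only [BoundedContinuousFunction.coe_neg, Pi.neg_apply, integral_neg]
        linarith
      have hlip' : ∀ v w, |(-ψ) v - (-ψ) w| ≤ k * dist v w := fun v w => by
        have := hlip v w
        rw [abs_sub_comm] at this
        simpa [sub_eq_add_neg, add_comm] using this
      filter_upwards [(hZ.tendsto_outerExp_of_lipschitz hL hW happ (-ψ) hk
        hlip').eventually_lt_const hint'] with n hn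
      refine (outerExp_mono (fun ω => hb φ _) (fun ω => hb (-ψ) _) fun ω => ?_).trans_lt hn
      have := hle (hW n ω).toEllInf
      simp only [BoundedContinuousFunction.coe_neg, Pi.neg_apply]
      linarith

end Delta

/-! ### Distribution function and quantile function of a single curve -/

/-- The uniform law on `[0,1]`. -/
abbrev unif : Measure ℝ := volume.restrict (Icc (0 : ℝ) 1)

instance : IsProbabilityMeasure unif := ⟨by simp⟩

theorem unif_eq_restrict_Ioc : unif = volume.restrict (Ioc (0 : ℝ) 1) :=
  Measure.restrict_congr_set Ioc_ae_eq_Icc.symm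

/-- The distribution function of `q(U)` for `U` uniform. -/
def cdfU (q : ℝ → ℝ) (y : ℝ) : ℝ :=
  ∫ u in Icc (0 : ℝ) 1, Set.indicator {u | q u ≤ y} (fun _ => (1 : ℝ)) u

/-- The quantile function of `q(U)` for `U` uniform. -/
def quantU (q : ℝ → ℝ) (u : ℝ) : ℝ := sInf {y : ℝ | u ≤ cdfU q y}

/-- The integrated distribution function `∫ (y - q(u))₊ du`. -/
def intCdf (q : ℝ → ℝ) (y : ℝ) : ℝ := ∫ u, max (y - q u) 0 ∂unif

/-- The integrated quantile function `∫₀ᵇ q^*(u) du`. -/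
def intQuant (q : ℝ → ℝ) (b : ℝ) : ℝ := ∫ u in Ioc 0 b, quantU q u

/-- A measurable curve on `[0,1]` with values in `[-C, C]`. -/
structure BddCurve (q : ℝ → ℝ) (C : ℝ) : Prop where
  aemeas : AEMeasurable q unif
  bound : ∀ u ∈ Icc (0 : ℝ) 1, |q u| ≤ C

namespace BddCurve

variable {q : ℝ → ℝ} {C : ℝ} (hq : BddCurve q C)

include hq

theorem integrable : Integrable q unif :=
  Integrable.of_bound hq.aemeas.aestronglyMeasurable C
    ((ae_restrict_mem measurableSet_Icc).mono hq.bound)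

theorem nullMeasurableSet_le (y : ℝ) : NullMeasurableSet {u | q u ≤ y} unif :=
  hq.aemeas.nullMeasurableSet_preimage measurableSet_Iic

theorem cdfU_eq_real (y : ℝ) : cdfU q y = unif.real {u | q u ≤ y} := by
  rw [cdfU, integral_indicator₀ (hq.nullMeasurableSet_le y)]
  simp [Measure.real]

theorem cdfU_eq_cdf (y : ℝ) : cdfU q y = ProbabilityTheory.cdf (unif.map q) y := by
  have := Measure.isProbabilityMeasure_map hq.aemeas
  rw [hq.cdfU_eq_real, ProbabilityTheory.cdf_eq_real, Measure.real, Measure.real,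
    Measure.map_apply_of_aemeasurable hq.aemeas measurableSet_Iic]
  rfl

theorem cdfU_mono : Monotone (cdfU q) := fun a b hab => by
  rw [hq.cdfU_eq_cdf, hq.cdfU_eq_cdf]
  exact (ProbabilityTheory.cdf (unif.map q)).mono hab

theorem measurable_cdfU : Measurable (cdfU q) := hq.cdfU_mono.measurable

theorem cdfU_nonneg (y : ℝ) : 0 ≤ cdfU q y := by
  rw [hq.cdfU_eq_real]
  exact measureReal_nonneg

theorem cdfU_le_one (y : ℝ) : cdfU q y ≤ 1 := by
  rw [hq.cdfU_eq_real]
  exact measureReal_le_one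

theorem cdfU_of_le {y : ℝ} (hy : C ≤ y) : cdfU q y = 1 := by
  rw [hq.cdfU_eq_real, ← probReal_univ (μ := unif)]
  refine measureReal_congr ?_
  filter_upwards [ae_restrict_mem measurableSet_Icc] with u hu
  refine propext ⟨fun _ => trivial, fun _ => ?_⟩
  exact ((abs_le.1 (hq.bound u hu)).2).trans hy

theorem cdfU_of_lt {y : ℝ} (hy : y < -C) : cdfU q y = 0 := by
  rw [hq.cdfU_eq_real, ← measureReal_empty (μ := unif)]
  refine measureReal_congr ?_
  filter_upwards [ae_restrict_mem measurableSet_Icc] with u hu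
  refine propext ⟨fun h => ?_, fun h => h.elim⟩
  have h1 := (abs_le.1 (hq.bound u hu)).1
  have h2 : q u ≤ y := h
  linarith

/-- The Galois connection between distribution and quantile function: right-continuity makes the
infimum attained. It fails at `u = 0`, where the set is all of `ℝ`, hence `Ioc`. -/
theorem le_cdfU_iff {u : ℝ} (hu : u ∈ Ioc (0 : ℝ) 1) (y : ℝ) : u ≤ cdfU q y ↔ quantU q u ≤ y := by
  have hbdd : BddBelow {y : ℝ | u ≤ cdfU q y} := ⟨-C, fun z hz => by
    by_contra! h
    have hz' : u ≤ cdfU q z := hz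
    rw [hq.cdfU_of_lt h] at hz'
    linarith [hu.1]⟩
  have hne : {y : ℝ | u ≤ cdfU q y}.Nonempty := ⟨C, by
    simpa [hq.cdfU_of_le le_rfl] using hu.2⟩
  refine ⟨fun h => csInf_le hbdd h, fun h => ?_⟩
  refine le_trans ?_ (hq.cdfU_mono h)
  have hlim : Tendsto (cdfU q) (𝓝[>] (quantU q u)) (𝓝 (cdfU q (quantU q u))) := by
    have h1 := (ProbabilityTheory.cdf (unif.map q)).right_continuous (quantU q u)
    have h2 : cdfU q = ProbabilityTheory.cdf (unif.map q) := funext hq.cdfU_eq_cdf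
    rw [h2]
    exact h1.mono_left (nhdsWithin_mono _ Ioi_subset_Ici_self)
  refine ge_of_tendsto hlim ?_
  filter_upwards [self_mem_nhdsWithin] with y hy
  obtain ⟨s, hs, hsy⟩ := exists_lt_of_csInf_lt hne hy
  exact (show u ≤ cdfU q s from hs).trans (hq.cdfU_mono hsy.le)

theorem abs_quantU_le {u : ℝ} (hu : u ∈ Ioc (0 : ℝ) 1) : |quantU q u| ≤ C := by
  refine abs_le.2 ⟨?_, (hq.le_cdfU_iff hu C).1 (by simpa [hq.cdfU_of_le le_rfl] using hu.2)⟩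
  by_contra! h
  have := (hq.le_cdfU_iff hu _).2 le_rfl
  rw [hq.cdfU_of_lt h] at this
  linarith [hu.1]

theorem monotoneOn_quantU : MonotoneOn (quantU q) (Ioc 0 1) := fun _ hu _ hv huv =>
  (hq.le_cdfU_iff hu _).1 (huv.trans ((hq.le_cdfU_iff hv _).2 le_rfl))

theorem aemeasurable_quantU : AEMeasurable (quantU q) unif := by
  rw [unif_eq_restrict_Ioc]
  exact aemeasurable_restrict_of_monotoneOn measurableSet_Ioc hq.monotoneOn_quantU

theorem integrableOn_quantU : IntegrableOn (quantU q) (Ioc 0 1) := by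
  have h := hq.aemeasurable_quantU
  rw [unif_eq_restrict_Ioc] at h
  exact Integrable.of_bound h.aestronglyMeasurable C
    ((ae_restrict_mem measurableSet_Ioc).mono fun _ => hq.abs_quantU_le)

/-- The quantile function has the same law as the curve. -/
theorem map_quantU : unif.map (quantU q) = unif.map q := by
  have := Measure.isProbabilityMeasure_map hq.aemeasurable_quantU
  refine Measure.ext_of_Iic _ _ fun y => ?_
  rw [Measure.map_apply_of_aemeasurable hq.aemeas measurableSet_Iic,
    Measure.map_apply_of_aemeasurable hq.aemeasurable_quantU measurableSet_Iic]
  have h1 : unif (q ⁻¹' Iic y) = ENNReal.ofReal (cdfU q y) := by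
    rw [hq.cdfU_eq_real, ofReal_measureReal]
    rfl
  have h2 : unif (Ioc 0 (cdfU q y)) = ENNReal.ofReal (cdfU q y) := by
    rw [unif_eq_restrict_Ioc, Measure.restrict_apply measurableSet_Ioc,
      inter_eq_left.2 (Ioc_subset_Ioc_right (hq.cdfU_le_one y))]
    simp
  rw [h1, ← h2]
  refine measure_congr ?_
  rw [unif_eq_restrict_Ioc]
  filter_upwards [ae_restrict_mem measurableSet_Ioc] with u hu
  exact propext ⟨fun h => ⟨hu.1, (hq.le_cdfU_iff hu y).2 h⟩, fun h => (hq.le_cdfU_iff hu y).1 h.2⟩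

theorem integral_comp_quantU {f : ℝ → ℝ} (hf : Measurable f) :
    ∫ u, f (quantU q u) ∂unif = ∫ u, f (q u) ∂unif := by
  rw [← integral_map hq.aemeasurable_quantU hf.aestronglyMeasurable, hq.map_quantU,
    integral_map hq.aemeas hf.aestronglyMeasurable]

/-- Fenchel's inequality for the conjugate pair `intCdf`, `intQuant`: integrate `y - q^* ≤ (y -
q^*)₊` over `(0, b]` and enlarge the domain on the right. -/
theorem mul_sub_intCdf_le {b : ℝ} (hb : b ∈ Icc (0 : ℝ) 1) (y : ℝ) :
    b * y - intCdf q y ≤ intQuant q b := by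
  have hi := hq.integrableOn_quantU
  have hib := hi.mono_set (Ioc_subset_Ioc_right hb.2)
  have h1 : ∫ u in Ioc 0 b, (y - quantU q u) = b * y - intQuant q b := by
    rw [integral_sub (integrable_const _) hib]
    simp [hb.1, intQuant]
  have hmax : IntegrableOn (fun u => max (y - quantU q u) 0) (Ioc 0 1) :=
    ((integrable_const y).sub hi).sup (integrable_const 0)
  have h2 : intCdf q y = ∫ u in Ioc 0 1, max (y - quantU q u) 0 := by
    rw [intCdf, ← hq.integral_comp_quantU (f := fun z => max (y - z) 0) (by fun_prop),
      unif_eq_restrict_Ioc]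
  have h3 : ∫ u in Ioc 0 b, (y - quantU q u) ≤ ∫ u in Ioc 0 b, max (y - quantU q u) 0 :=
    integral_mono ((integrable_const y).sub hib)
      (hmax.mono_set (Ioc_subset_Ioc_right hb.2)) fun u => le_max_left _ _
  have h4 : ∫ u in Ioc 0 b, max (y - quantU q u) 0 ≤ ∫ u in Ioc 0 1, max (y - quantU q u) 0 :=
    setIntegral_mono_set hmax (ae_of_all _ fun u => le_max_right _ _)
      (Ioc_subset_Ioc_right hb.2).eventuallyLE
  linarith

/-- The case of equality: at `y = q^*(b)` the positive part is `y - q^*` on `(0, b]` and vanishes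
beyond, by monotonicity. -/
theorem intQuant_eq {b : ℝ} (hb : b ∈ Ioc (0 : ℝ) 1) :
    intQuant q b = b * quantU q b - intCdf q (quantU q b) := by
  have hib := hq.integrableOn_quantU.mono_set (Ioc_subset_Ioc_right hb.2)
  set y := quantU q b with hy
  have h1 : ∫ u in Ioc 0 b, (y - quantU q u) = b * y - intQuant q b := by
    rw [integral_sub (integrable_const _) hib]
    simp [hb.1.le, intQuant]
  have h2 : intCdf q y = ∫ u in Ioc 0 1, max (y - quantU q u) 0 := by
    rw [intCdf, ← hq.integral_comp_quantU (f := fun z => max (y - z) 0) (by fun_prop),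
      unif_eq_restrict_Ioc]
  have h3 : ∫ u in Ioc 0 1, max (y - quantU q u) 0 = ∫ u in Ioc 0 b, max (y - quantU q u) 0 := by
    refine setIntegral_eq_of_subset_of_forall_sdiff_eq_zero measurableSet_Ioc
      (Ioc_subset_Ioc_right hb.2) fun u hu => max_eq_right (sub_nonpos.2 ?_)
    refine hq.monotoneOn_quantU hb hu.1 ?_
    by_contra! h
    exact hu.2 ⟨hu.1.1, h.le⟩
  have h4 : ∫ u in Ioc 0 b, max (y - quantU q u) 0 = ∫ u in Ioc 0 b, (y - quantU q u) := by
    refine setIntegral_congr_fun measurableSet_Ioc fun u hu => max_eq_left (sub_nonneg.2 ?_)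
    exact hq.monotoneOn_quantU ⟨hu.1, hu.2.trans hb.2⟩ hb hu.2
  linarith

theorem integrable_posPart (y : ℝ) : Integrable (fun u => max (y - q u) 0) unif :=
  ((integrable_const y).sub hq.integrable).sup (integrable_const 0)

/-- `intCdf` is a primitive of the distribution function. -/
theorem integral_cdfU {a b : ℝ} (hab : a ≤ b) :
    ∫ y in Ioc a b, cdfU q y = intCdf q b - intCdf q a := by
  have hint : Integrable (Function.uncurry fun y u => Set.indicator {u | q u ≤ y}
      (fun _ => (1 : ℝ)) u) ((volume.restrict (Ioc a b)).prod unif) := by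
    have hset : NullMeasurableSet {p : ℝ × ℝ | q p.2 ≤ p.1} ((volume.restrict (Ioc a b)).prod unif) :=
      _root_.nullMeasurableSet_le hq.aemeas.comp_snd measurable_fst.aemeasurable
    have : (Function.uncurry fun y u => Set.indicator {u | q u ≤ y} (fun _ => (1 : ℝ)) u) =
        Set.indicator {p : ℝ × ℝ | q p.2 ≤ p.1} (fun _ => (1 : ℝ)) := by
      ext p
      simp [Function.uncurry, Set.indicator]
    rw [this]
    exact (integrable_const (1 : ℝ)).indicator₀ hset
  have hinner : ∀ c : ℝ, ∫ y in Ioc a b, Set.indicator (Ici c) (fun _ => (1 : ℝ)) y =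
      max (b - c) 0 - max (a - c) 0 := by
    intro c
    rw [setIntegral_indicator measurableSet_Ici]
    rcases le_or_gt c a with h | h
    · have : Ioc a b ∩ Ici c = Ioc a b := inter_eq_left.2 fun u hu => h.trans hu.1.le
      rw [this, max_eq_left (by linarith), max_eq_left (by linarith)]
      simp [hab]
    · have : Ioc a b ∩ Ici c = Icc c b := by
        ext u
        simp only [mem_inter_iff, mem_Ioc, mem_Ici, mem_Icc]
        constructor
        · rintro ⟨⟨-, h2⟩, h3⟩
          exact ⟨h3, h2⟩
        · rintro ⟨h2, h3⟩
          exact ⟨⟨by linarith, h3⟩, h2⟩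
      rw [this, max_eq_right (by linarith : a - c ≤ 0)]
      simp
  calc ∫ y in Ioc a b, cdfU q y
      = ∫ u, (∫ y in Ioc a b, Set.indicator {u | q u ≤ y} (fun _ => (1 : ℝ)) u) ∂unif :=
        integral_integral_swap hint
    _ = ∫ u, (max (b - q u) 0 - max (a - q u) 0) ∂unif := by
        refine integral_congr_ae (ae_of_all _ fun u => ?_)
        simp only
        rw [← hinner]
        rfl
    _ = _ := integral_sub (hq.integrable_posPart b) (hq.integrable_posPart a)

end BddCurve

/-! ### Smoothing as an average -/

theorem boxKernel_mul_eq_indicator (δ z y c : ℝ) :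
    boxKernel δ (z - y) * c = Set.indicator (Icc (z - δ) (z + δ)) (fun _ => 1 / (2 * δ) * c) y := by
  have : z - y ∈ {v : ℝ | |v| ≤ δ} ↔ y ∈ Icc (z - δ) (z + δ) := by
    simp only [mem_ofPred_eq, abs_le, mem_Icc]
    constructor <;> rintro ⟨h1, h2⟩ <;> constructor <;> linarith
  by_cases h : y ∈ Icc (z - δ) (z + δ)
  · rw [boxKernel, indicator_of_mem (this.2 h), indicator_of_mem h]
  · rw [boxKernel, indicator_of_notMem (mt this.1 h), indicator_of_notMem h, zero_mul]

theorem smooth_eq (A : Set ℝ) (δ : ℝ) (f : ℝ → ℝ) (z : ℝ) :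
    smooth A δ f z = 1 / (2 * δ) * ∫ y in A ∩ Icc (z - δ) (z + δ), f y := by
  have : ∀ y, boxKernel δ (z - y) * f y =
      Set.indicator (Icc (z - δ) (z + δ)) (fun y => 1 / (2 * δ) * f y) y := fun y => by
    rw [boxKernel_mul_eq_indicator]
    rfl
  rw [smooth]
  simp only [this]
  rw [setIntegral_indicator measurableSet_Icc, integral_const_mul]

/-- The smoothed distribution function is a difference quotient of `intCdf`, so only `intCdf` has to
be expanded in the curve. -/
theorem smooth_cdfU {q : ℝ → ℝ} {C : ℝ} (hq : BddCurve q C) {δ : ℝ} (hδ : 0 < δ) (z : ℝ) :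
    smooth univ δ (cdfU q) z = 1 / (2 * δ) * (intCdf q (z + δ) - intCdf q (z - δ)) := by
  rw [smooth_eq, univ_inter, integral_Icc_eq_integral_Ioc, hq.integral_cdfU (by linarith)]

theorem smooth_quantU {q : ℝ → ℝ} {C : ℝ} (hq : BddCurve q C) {δ : ℝ} (hδ : 0 < δ) {z : ℝ}
    (hz : z ∈ Icc (0 : ℝ) 1) :
    smooth (Icc 0 1) δ (quantU q) z =
      1 / (2 * δ) * (intQuant q (min 1 (z + δ)) - intQuant q (max 0 (z - δ))) := by
  have h01 : max 0 (z - δ) ≤ min 1 (z + δ) := by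
    simp only [max_le_iff, le_min_iff]
    exact ⟨⟨zero_le_one, by linarith [hz.2]⟩, by linarith [hz.1], by linarith⟩
  have hU : Ioc 0 (max 0 (z - δ)) ∪ Ioc (max 0 (z - δ)) (min 1 (z + δ)) = Ioc 0 (min 1 (z + δ)) :=
    Ioc_union_Ioc_eq_Ioc (le_max_left _ _) h01
  have hi : IntegrableOn (quantU q) (Ioc 0 (min 1 (z + δ))) :=
    hq.integrableOn_quantU.mono_set (Ioc_subset_Ioc_right (min_le_left _ _))
  rw [← hU] at hi
  rw [smooth_eq, Icc_inter_Icc, integral_Icc_eq_integral_Ioc]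
  change _ * ∫ y in Ioc (max 0 (z - δ)) (min 1 (z + δ)), quantU q y = _
  rw [intQuant, intQuant, ← hU, setIntegral_union _ measurableSet_Ioc hi.left_of_union
    hi.right_of_union]
  · ring
  · exact Set.disjoint_left.2 fun u hu hu' => absurd hu.2 (not_le.2 hu'.1)

/-! ### First-order expansions -/

/-- The map `(y - ·)₊` is affine on each side of its kink, so the linearisation is exact unless `y`
separates `a` from `b`, which forces `|a - y| ≤ ε`. -/
theorem abs_posPart_expansion {a b y ε : ℝ} (h : |b - a| ≤ ε) :
    |max (y - b) 0 - max (y - a) 0 + (if a ≤ y then b - a else 0)| ≤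
      if |a - y| ≤ ε then ε else 0 := by
  have h0 : 0 ≤ ε := (abs_nonneg _).trans h
  rw [abs_le] at h
  have hcase : |a - y| ≤ ε ↔ a - y ≤ ε ∧ y - a ≤ ε := by
    rw [abs_le]
    constructor <;> rintro ⟨h1, h2⟩ <;> constructor <;> linarith
  rcases le_total (y - b) 0 with hb | hb <;> rcases le_total (y - a) 0 with ha | ha <;>
    simp only [max_eq_left, max_eq_right, hb, ha] <;> split_ifs with h1 h2 h2 <;>
    rw [hcase] at h2 <;> rw [abs_le] <;>
    first
    | (constructor <;> linarith)
    | (exfalso; apply h2; constructor <;> linarith)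

namespace BddCurve

variable {q r : ℝ → ℝ} {C D ε w : ℝ}

theorem nullMeasurableSet_tube (hq : BddCurve q C) (y ε : ℝ) :
    NullMeasurableSet {u | |q u - y| ≤ ε} unif :=
  hq.aemeas.nullMeasurableSet_preimage
    (s := {z | |z - y| ≤ ε}) (measurableSet_le (by fun_prop) measurable_const)

theorem integrable_indicator_le {h : ℝ → ℝ} (hh : Integrable h unif) (hq : AEMeasurable q unif)
    (y : ℝ) : Integrable (fun u => if q u ≤ y then h u else 0) unif := by
  have := hh.indicator₀ (hq.nullMeasurableSet_preimage (measurableSet_Iic (a := y)))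
  refine this.congr (ae_of_all _ fun u => ?_)
  simp [Set.indicator]

/-- The primitive of the distribution function is differentiable in the curve, with a remainder
controlled by the mass of a tube around the level. -/
theorem abs_intCdf_sub_add_le (hq : BddCurve q C) (hr : BddCurve r D)
    (hε : ∀ u ∈ Icc (0 : ℝ) 1, |r u - q u| ≤ ε) (y : ℝ) :
    |intCdf r y - intCdf q y + ∫ u, (if q u ≤ y then r u - q u else 0) ∂unif| ≤
      ε * unif.real {u | |q u - y| ≤ ε} := by
  have hi := integrable_indicator_le (hr.integrable.sub hq.integrable) hq.aemeas y
  simp only [Pi.sub_apply] at hi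
  have h1 := integral_sub (hr.integrable_posPart y) (hq.integrable_posPart y)
  have h2 := integral_add ((hr.integrable_posPart y).sub (hq.integrable_posPart y)) hi
  simp only [Pi.sub_apply] at h2
  rw [intCdf, intCdf, ← h1, ← h2, ← Real.norm_eq_abs]
  have h3 : ∫ u, Set.indicator {u | |q u - y| ≤ ε} (fun _ => ε) u ∂unif =
      ε * unif.real {u | |q u - y| ≤ ε} := by
    rw [integral_indicator₀ (hq.nullMeasurableSet_tube y ε)]
    simp [Measure.real, mul_comm]
  rw [← h3]
  refine norm_integral_le_of_norm_le
    ((integrable_const ε).indicator₀ (hq.nullMeasurableSet_tube y ε)) ?_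
  filter_upwards [ae_restrict_mem measurableSet_Icc] with u hu
  have := abs_posPart_expansion (y := y) (hε u hu)
  simpa [Set.indicator] using this

/-- The set `{q ≤ y}` lies in `{r ≤ y + ε}` on `[0,1]`. In its two-sided form this says that
rearrangement does not increase uniform distances. -/
theorem quantU_le_add (hq : BddCurve q C) (hr : BddCurve r D)
    (hε : ∀ u ∈ Icc (0 : ℝ) 1, |r u - q u| ≤ ε) {b : ℝ} (hb : b ∈ Ioc (0 : ℝ) 1) :
    quantU r b ≤ quantU q b + ε := by
  rw [← hr.le_cdfU_iff hb]
  refine ((hq.le_cdfU_iff hb _).2 le_rfl).trans ?_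
  rw [hq.cdfU_eq_real, hr.cdfU_eq_real, Measure.real, Measure.real]
  refine ENNReal.toReal_mono (measure_ne_top _ _) (measure_mono_ae ?_)
  filter_upwards [ae_restrict_mem measurableSet_Icc] with u hu h
  have h1 := (abs_le.1 (hε u hu)).2
  have h2 : q u ≤ quantU q b := h
  change r u ≤ _
  linarith

theorem abs_quantU_sub_le (hq : BddCurve q C) (hr : BddCurve r D)
    (hε : ∀ u ∈ Icc (0 : ℝ) 1, |r u - q u| ≤ ε) {b : ℝ} (hb : b ∈ Ioc (0 : ℝ) 1) :
    |quantU r b - quantU q b| ≤ ε := by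
  have h1 := hq.quantU_le_add hr hε hb
  have h2 := hr.quantU_le_add hq (fun u hu => by rw [abs_sub_comm]; exact hε u hu) hb
  exact abs_le.2 ⟨by linarith, by linarith⟩

/-- The two indicators differ only where `q` lies between `y` and `y'`, inside the tube around `y`.
-/
theorem abs_integral_level_sub_le (hq : BddCurve q C) (hr : BddCurve r D)
    (hε : ∀ u ∈ Icc (0 : ℝ) 1, |r u - q u| ≤ ε) {y y' : ℝ} (hy : |y' - y| ≤ ε) :
    |∫ u, (if q u ≤ y' then r u - q u else 0) ∂unif -
      ∫ u, (if q u ≤ y then r u - q u else 0) ∂unif| ≤ ε * unif.real {u | |q u - y| ≤ ε} := by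
  have hi := fun y => integrable_indicator_le (hr.integrable.sub hq.integrable) hq.aemeas y
  simp only [Pi.sub_apply] at hi
  rw [← integral_sub (hi y') (hi y), ← Real.norm_eq_abs]
  have h3 : ∫ u, Set.indicator {u | |q u - y| ≤ ε} (fun _ => ε) u ∂unif =
      ε * unif.real {u | |q u - y| ≤ ε} := by
    rw [integral_indicator₀ (hq.nullMeasurableSet_tube y ε)]
    simp [Measure.real, mul_comm]
  rw [← h3]
  refine norm_integral_le_of_norm_le
    ((integrable_const ε).indicator₀ (hq.nullMeasurableSet_tube y ε)) ?_
  filter_upwards [ae_restrict_mem measurableSet_Icc] with u hu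
  have h1 := hε u hu
  have h0 : 0 ≤ ε := (abs_nonneg _).trans h1
  rw [abs_le] at hy
  simp only [Set.indicator, mem_ofPred_eq, Real.norm_eq_abs]
  by_cases ha : q u ≤ y' <;> by_cases hb : q u ≤ y <;> simp only [ha, hb, if_true, if_false]
  · rw [sub_self, abs_zero]
    split_ifs <;> linarith
  · have : |q u - y| ≤ ε := abs_le.2 ⟨by linarith, by linarith⟩
    rw [if_pos this, sub_zero]
    exact h1
  · have : |q u - y| ≤ ε := abs_le.2 ⟨by linarith, by linarith⟩
    rw [if_pos this, zero_sub, abs_neg]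
    exact h1
  · rw [sub_self, abs_zero]
    split_ifs <;> linarith

/-- The integrated quantile function is differentiable in the curve. -/
theorem abs_intQuant_sub_sub_le (hq : BddCurve q C) (hr : BddCurve r D)
    (hε : ∀ u ∈ Icc (0 : ℝ) 1, |r u - q u| ≤ ε) (hw : ∀ y, unif.real {u | |q u - y| ≤ ε} ≤ w)
    {b : ℝ} (hb : b ∈ Ioc (0 : ℝ) 1) :
    |intQuant r b - intQuant q b - ∫ u, (if q u ≤ quantU q b then r u - q u else 0) ∂unif| ≤
      2 * (ε * w) := by
  have h0 : 0 ≤ ε := (abs_nonneg _).trans (hε 0 ⟨le_rfl, zero_le_one⟩)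
  have hεw : ∀ y, ε * unif.real {u | |q u - y| ≤ ε} ≤ ε * w := fun y =>
    mul_le_mul_of_nonneg_left (hw y) h0
  have hb' : b ∈ Icc (0 : ℝ) 1 := ⟨hb.1.le, hb.2⟩
  -- Envelope argument. The maximiser of `q` is a competitor for `r`, which bounds the difference
  -- from below; the maximiser of `r` is a competitor for `q`, which bounds it from above. The upper
  -- bound has its level at `r^*(b)`, and moving it to `q^*(b)` costs the second `ε * w`.
  have e1 := hq.intQuant_eq hb
  have e2 := hr.intQuant_eq hb
  have i1 := hr.mul_sub_intCdf_le hb' (quantU q b)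
  have i2 := hq.mul_sub_intCdf_le hb' (quantU r b)
  have a1 := (abs_le.1 (hq.abs_intCdf_sub_add_le hr hε (quantU q b))).2
  have a2 := (abs_le.1 (hq.abs_intCdf_sub_add_le hr hε (quantU r b))).1
  have a3 := (abs_le.1 (hq.abs_integral_level_sub_le hr hε (hq.abs_quantU_sub_le hr hε hb))).2
  have w1 := hεw (quantU q b)
  have w2 := hεw (quantU r b)
  have w0 : 0 ≤ ε * w := (mul_nonneg h0 measureReal_nonneg).trans w1
  exact abs_le.2 ⟨by linarith, by linarith⟩

/-! ### Curves without flat parts -/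

section NoAtoms

variable {h : ℝ → ℝ}

/-- The kernel window is closed whereas a difference of level sets is half-open; the discrepancy is
the level set at `z - δ`, which is null. -/
theorem integral_boxKernel_mul (hq : AEMeasurable q unif) (hna : ∀ y, unif {u | q u = y} = 0)
    (hh : Integrable h unif) {δ : ℝ} (hδ : 0 < δ) (z : ℝ) :
    ∫ u, boxKernel δ (z - q u) * h u ∂unif = 1 / (2 * δ) *
      (∫ u, (if q u ≤ z + δ then h u else 0) ∂unif -
        ∫ u, (if q u ≤ z - δ then h u else 0) ∂unif) := by
  rw [← integral_sub (integrable_indicator_le hh hq _) (integrable_indicator_le hh hq _),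
    ← integral_const_mul]
  refine integral_congr_ae ?_
  have hne : ∀ᵐ u ∂unif, q u ≠ z - δ := by
    rw [ae_iff]
    simpa using hna (z - δ)
  filter_upwards [hne] with u hu
  rw [boxKernel_mul_eq_indicator]
  simp only [Set.indicator, mem_Icc]
  rcases lt_or_gt_of_ne hu with h1 | h1
  · rw [if_neg (fun h2 => by linarith [h2.1]), if_pos (by linarith), if_pos h1.le]
    simp
  · rw [if_neg (not_le.2 h1), sub_zero]
    by_cases h2 : q u ≤ z + δ
    · rw [if_pos ⟨h1.le, h2⟩, if_pos h2]
    · rw [if_neg (fun h3 => h2 h3.2), if_neg h2, mul_zero]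

/-- Without atoms `{q ≤ q^*(b)}` has the mass of `{q < q^*(b)}`, hence of `{q^* < q^*(b)}` by
equality in law, and the last set is contained in `(0, b]` up to a null set. -/
theorem cdfU_quantU (hq : BddCurve q C) (hna : ∀ y, unif {u | q u = y} = 0) {b : ℝ}
    (hb : b ∈ Ioc (0 : ℝ) 1) : cdfU q (quantU q b) = b := by
  refine le_antisymm ?_ ((hq.le_cdfU_iff hb _).2 le_rfl)
  have h1 : unif {u | q u ≤ quantU q b} = unif {u | q u < quantU q b} := by
    refine measure_congr ?_
    have hne : ∀ᵐ u ∂unif, q u ≠ quantU q b := by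
      rw [ae_iff]
      simpa using hna (quantU q b)
    filter_upwards [hne] with u hu
    exact propext ⟨fun h => lt_of_le_of_ne h hu, fun h => le_of_lt h⟩
  have h2 : unif {u | q u < quantU q b} = unif {u | quantU q u < quantU q b} := by
    have : unif.map (quantU q) (Iio (quantU q b)) = unif.map q (Iio (quantU q b)) := by
      rw [hq.map_quantU]
    rw [Measure.map_apply_of_aemeasurable hq.aemeas measurableSet_Iio,
      Measure.map_apply_of_aemeasurable hq.aemeasurable_quantU measurableSet_Iio] at this
    exact this.symm
  have h3 : unif {u | quantU q u < quantU q b} ≤ unif (Ioc 0 b) := by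
    refine measure_mono_ae ?_
    rw [unif_eq_restrict_Ioc]
    filter_upwards [ae_restrict_mem measurableSet_Ioc] with u hu h
    refine ⟨hu.1, ?_⟩
    by_contra! hlt
    exact absurd (hq.monotoneOn_quantU hb hu hlt.le) (not_le.2 h)
  have h4 : unif (Ioc 0 b) = ENNReal.ofReal b := by
    rw [unif_eq_restrict_Ioc, Measure.restrict_apply measurableSet_Ioc,
      inter_eq_left.2 (Ioc_subset_Ioc_right hb.2)]
    simp
  rw [hq.cdfU_eq_real, Measure.real, h1, h2]
  refine ENNReal.toReal_le_of_le_ofReal hb.1.le (h3.trans h4.le)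

/-- The probability integral transform: `q` may be replaced by `q^*`, for which `F ∘ q^*` is the
identity on `(0, 1]`. Thus `F ∘ q` has no atoms either. -/
theorem measure_cdfU_eq (hq : BddCurve q C) (hna : ∀ y, unif {u | q u = y} = 0) (b : ℝ) :
    unif {u | cdfU q (q u) = b} = 0 := by
  have hs : MeasurableSet {z | cdfU q z = b} := hq.measurable_cdfU (measurableSet_singleton b)
  have : unif.map (quantU q) {z | cdfU q z = b} = unif.map q {z | cdfU q z = b} := by
    rw [hq.map_quantU]
  rw [Measure.map_apply_of_aemeasurable hq.aemeas hs,
    Measure.map_apply_of_aemeasurable hq.aemeasurable_quantU hs] at this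
  change unif (q ⁻¹' {z | cdfU q z = b}) = 0
  rw [← this]
  have hle : unif (quantU q ⁻¹' {z | cdfU q z = b}) ≤ unif {b} := by
    refine measure_mono_ae ?_
    rw [unif_eq_restrict_Ioc]
    filter_upwards [ae_restrict_mem measurableSet_Ioc] with u hu h
    have h1 : cdfU q (quantU q u) = b := h
    rw [hq.cdfU_quantU hna hu] at h1
    exact h1
  exact le_antisymm (hle.trans (by simp)) bot_le

theorem aemeasurable_cdfU_comp (hq : BddCurve q C) : AEMeasurable (fun u => cdfU q (q u)) unif :=
  hq.measurable_cdfU.comp_aemeasurable hq.aemeas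

/-- The two level sets can differ only on `{F ∘ q = b}`, which is null. This expresses the quantile
expansion through the curve `F ∘ q`. -/
theorem integral_cdfU_level_eq (hq : BddCurve q C) (hna : ∀ y, unif {u | q u = y} = 0) {b : ℝ}
    (hb : b ∈ Ioc (0 : ℝ) 1) :
    ∫ u, (if cdfU q (q u) ≤ b then h u else 0) ∂unif =
      ∫ u, (if q u ≤ quantU q b then h u else 0) ∂unif := by
  refine integral_congr_ae ?_
  have hne : ∀ᵐ u ∂unif, cdfU q (q u) ≠ b := by
    rw [ae_iff]
    simpa using hq.measure_cdfU_eq hna b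
  filter_upwards [hne] with u hu
  have : cdfU q (q u) ≤ b ↔ q u ≤ quantU q b := by
    constructor
    · intro h1
      by_contra! h2
      have h3 := hq.cdfU_mono h2.le
      rw [hq.cdfU_quantU hna hb] at h3
      exact hu (le_antisymm h1 h3)
    · intro h1
      have h3 := hq.cdfU_mono h1
      rwa [hq.cdfU_quantU hna hb] at h3
  simp only [this]

theorem integral_cdfU_nonpos_level (hq : BddCurve q C) (hna : ∀ y, unif {u | q u = y} = 0) {b : ℝ}
    (hb : b ≤ 0) : ∫ u, (if cdfU q (q u) ≤ b then h u else 0) ∂unif = 0 := by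
  refine integral_eq_zero_of_ae ?_
  have hne : ∀ᵐ u ∂unif, cdfU q (q u) ≠ 0 := by
    rw [ae_iff]
    simpa using hq.measure_cdfU_eq hna 0
  filter_upwards [hne] with u hu
  exact if_neg fun h1 : cdfU q (q u) ≤ b => hu (le_antisymm (h1.trans hb) (hq.cdfU_nonneg _))

/-- Expansion of the smoothed distribution function. -/
theorem abs_smooth_cdfU_sub_le (hq : BddCurve q C) (hr : BddCurve r D)
    (hna : ∀ y, unif {u | q u = y} = 0)
    (hε : ∀ u ∈ Icc (0 : ℝ) 1, |r u - q u| ≤ ε) (hw : ∀ y, unif.real {u | |q u - y| ≤ ε} ≤ w)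
    {δ : ℝ} (hδ : 0 < δ) (z : ℝ) :
    |smooth univ δ (cdfU r) z - smooth univ δ (cdfU q) z -
      -∫ u, boxKernel δ (z - q u) * (r u - q u) ∂unif| ≤ ε * w / δ := by
  have h0 : 0 ≤ ε := (abs_nonneg _).trans (hε 0 ⟨le_rfl, zero_le_one⟩)
  have hεw : ∀ y, ε * unif.real {u | |q u - y| ≤ ε} ≤ ε * w := fun y =>
    mul_le_mul_of_nonneg_left (hw y) h0
  rw [smooth_cdfU hr hδ, smooth_cdfU hq hδ,
    integral_boxKernel_mul (h := fun u => r u - q u) hq.aemeas hna (hr.integrable.sub hq.integrable) hδ]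
  have a1 := (hq.abs_intCdf_sub_add_le hr hε (z + δ)).trans (hεw _)
  have a2 := (hq.abs_intCdf_sub_add_le hr hε (z - δ)).trans (hεw _)
  have e : ε * w / δ = 1 / (2 * δ) * (2 * (ε * w)) := by field_simp
  rw [e, ← mul_sub, sub_neg_eq_add, ← mul_add, abs_mul, abs_of_pos (by positivity : 0 < 1 / (2 * δ))]
  refine mul_le_mul_of_nonneg_left ?_ (by positivity)
  rw [abs_le] at a1 a2 ⊢
  constructor <;> linarith

/-- Expansion of the smoothed quantile function. -/
theorem abs_smooth_quantU_sub_le (hq : BddCurve q C) (hr : BddCurve r D)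
    (hna : ∀ y, unif {u | q u = y} = 0)
    (hε : ∀ u ∈ Icc (0 : ℝ) 1, |r u - q u| ≤ ε) (hw : ∀ y, unif.real {u | |q u - y| ≤ ε} ≤ w)
    {δ : ℝ} (hδ : 0 < δ) {z : ℝ} (hz : z ∈ Icc (0 : ℝ) 1) :
    |smooth (Icc 0 1) δ (quantU r) z - smooth (Icc 0 1) δ (quantU q) z -
      ∫ u, boxKernel δ (z - cdfU q (q u)) * (r u - q u) ∂unif| ≤ 2 * (ε * w) / δ := by
  have h0 : 0 ≤ ε := (abs_nonneg _).trans (hε 0 ⟨le_rfl, zero_le_one⟩)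
  have w0 : 0 ≤ ε * w := mul_nonneg h0 (measureReal_nonneg.trans (hw 0))
  have key : ∀ b ∈ Icc (0 : ℝ) 1, |intQuant r b - intQuant q b -
      ∫ u, (if cdfU q (q u) ≤ b then r u - q u else 0) ∂unif| ≤ 2 * (ε * w) := by
    intro b hb
    rcases eq_or_lt_of_le hb.1 with rfl | hpos
    · rw [hq.integral_cdfU_nonpos_level hna le_rfl]
      simp only [intQuant, Ioc_self, Measure.restrict_empty, integral_zero_measure, sub_zero,
        abs_zero]
      linarith
    · rw [hq.integral_cdfU_level_eq hna ⟨hpos, hb.2⟩]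
      exact hq.abs_intQuant_sub_sub_le hr hε hw ⟨hpos, hb.2⟩
  rw [smooth_quantU hr hδ hz, smooth_quantU hq hδ hz,
    integral_boxKernel_mul (h := fun u => r u - q u) hq.aemeasurable_cdfU_comp (hq.measure_cdfU_eq hna)
      (hr.integrable.sub hq.integrable) hδ]
  -- Clipping the window to `[0,1]` changes neither integral: `F ∘ q` takes values in `[0,1]` and is
  -- almost surely nonzero.
  have e1 : ∫ u, (if cdfU q (q u) ≤ z + δ then r u - q u else 0) ∂unif =
      ∫ u, (if cdfU q (q u) ≤ min 1 (z + δ) then r u - q u else 0) ∂unif := by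
    simp only [le_min_iff, hq.cdfU_le_one, true_and]
  have e2 : ∫ u, (if cdfU q (q u) ≤ z - δ then r u - q u else 0) ∂unif =
      ∫ u, (if cdfU q (q u) ≤ max 0 (z - δ) then r u - q u else 0) ∂unif := by
    rcases le_total 0 (z - δ) with h | h
    · rw [max_eq_right h]
    · rw [max_eq_left h, hq.integral_cdfU_nonpos_level hna h,
        hq.integral_cdfU_nonpos_level hna le_rfl]
  rw [e1, e2]
  have a1 := key (min 1 (z + δ)) ⟨le_min zero_le_one (by linarith [hz.1]), min_le_left _ _⟩
  have a2 := key (max 0 (z - δ)) ⟨le_max_left _ _, max_le zero_le_one (by linarith [hz.2])⟩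
  have e : 2 * (ε * w) / δ = 1 / (2 * δ) * (4 * (ε * w)) := by field_simp; ring
  rw [e, ← mul_sub, ← mul_sub, abs_mul, abs_of_pos (by positivity : 0 < 1 / (2 * δ))]
  refine mul_le_mul_of_nonneg_left ?_ (by positivity)
  rw [abs_le] at a1 a2 ⊢
  constructor <;> linarith

end NoAtoms

end BddCurve

/-! ### Change of variables along a curve with finitely many critical points -/

open Classical in
/-- The sum `∑ h(u) / |q'(u)|` over the roots `u ∈ [0,1]` of `q(u) = y`, at regular values `y`. -/
def rootSum (q h : ℝ → ℝ) (y : ℝ) : ℝ :=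
  if {u | u ∈ Icc (0 : ℝ) 1 ∧ q u = y}.Nonempty ∧
      ∀ u ∈ {u | u ∈ Icc (0 : ℝ) 1 ∧ q u = y}, derivWithin q (Icc 0 1) u ≠ 0 then
    ∑ᶠ u ∈ {u | u ∈ Icc (0 : ℝ) 1 ∧ q u = y}, h u / |derivWithin q (Icc 0 1) u| else 0

/-- The points of `[0,1]` off the finite set `A` with exactly `j` points of `A` below them. -/
def gap (A : Finset ℝ) (j : ℕ) : Set ℝ :=
  {u | (u ∈ Icc (0 : ℝ) 1 ∧ u ∉ A) ∧ (A.filter (· < u)).card = j}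

/-- The number of points of `A` below `u` is monotone in `u`, and a point of `A` strictly before `b`
would raise the count at `b`. Hence gaps are intervals. -/
theorem gap_eq_of_mem_Ioo {A : Finset ℝ} {j : ℕ} {a b c : ℝ} (ha : a ∈ gap A j) (hb : b ∈ gap A j)
    (hc : c ∈ Ioo a b) : c ∈ gap A j := by
  have hmono : ∀ {s t : ℝ}, s ≤ t → A.filter (· < s) ⊆ A.filter (· < t) := fun hst v hv => by
    rw [Finset.mem_filter] at hv ⊢
    exact ⟨hv.1, hv.2.trans_le hst⟩
  have h1 := Finset.card_le_card (hmono hc.1.le)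
  have h2 := Finset.card_le_card (hmono hc.2.le)
  rw [ha.2] at h1
  rw [hb.2] at h2
  refine ⟨⟨⟨ha.1.1.1.trans hc.1.le, hc.2.le.trans hb.1.1.2⟩, fun hA => ?_⟩, le_antisymm h2 h1⟩
  have h3 : A.filter (· < c) ⊂ A.filter (· < b) := by
    refine Finset.ssubset_iff_subset_ne.2 ⟨hmono hc.2.le, fun h => ?_⟩
    have : c ∈ A.filter (· < b) := Finset.mem_filter.2 ⟨hA, hc.2⟩
    rw [← h] at this
    exact lt_irrefl _ (Finset.mem_filter.1 this).2
  have h4 := Finset.card_lt_card h3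
  rw [hb.2] at h4
  omega

theorem measurableSet_gap (A : Finset ℝ) (j : ℕ) : MeasurableSet (gap A j) := by
  have : (gap A j).OrdConnected := ⟨fun a ha b hb c hc => by
    rcases eq_or_lt_of_le hc.1 with rfl | h1
    · exact ha
    rcases eq_or_lt_of_le hc.2 with rfl | h2
    · exact hb
    exact gap_eq_of_mem_Ioo ha hb ⟨h1, h2⟩⟩
  exact this.measurableSet

theorem gap_subset (A : Finset ℝ) (j : ℕ) : gap A j ⊆ Icc 0 1 := fun _ hu => hu.1.1

theorem integral_unif_eq_sum_gap (A : Finset ℝ) {h : ℝ → ℝ} (hh : Integrable h unif) :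
    ∫ u, h u ∂unif = ∑ j ∈ Finset.range (A.card + 1), ∫ u in gap A j, h u := by
  rw [← integral_biUnion_finset _ (fun j _ => measurableSet_gap A j)
    (fun i _ j _ hij => Set.disjoint_left.2 fun u hi hj => hij (hi.2.symm.trans hj.2))
    (fun j _ => IntegrableOn.mono_set hh (gap_subset A j))]
  refine setIntegral_congr_set ?_
  have hA : ∀ᵐ u ∂(volume : Measure ℝ), u ∉ (A : Set ℝ) :=
    measure_eq_zero_iff_ae_notMem.1 (A.finite_toSet.measure_zero _)
  filter_upwards [hA] with u hu
  refine propext ⟨fun h => ?_, fun h => ?_⟩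
  · refine mem_iUnion₂.2 ⟨(A.filter (· < u)).card, ?_, ⟨h, hu⟩, rfl⟩
    exact Finset.mem_range.2 (Nat.lt_succ_of_le (Finset.card_filter_le _ _))
  · obtain ⟨j, -, hj⟩ := mem_iUnion₂.1 h
    exact gap_subset A j hj

/-- A curve on `[0,1]`, differentiable with finitely many critical points. -/
structure TameCurve (q : ℝ → ℝ) : Prop where
  diff : DifferentiableOn ℝ q (Icc 0 1)
  finite_crit : {u | u ∈ Icc (0 : ℝ) 1 ∧ derivWithin q (Icc 0 1) u = 0}.Finite

namespace TameCurve

variable {q : ℝ → ℝ} (hq : TameCurve q)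

include hq

/-- The critical points. -/
def crit : Finset ℝ := hq.finite_crit.toFinset

theorem mem_crit {u : ℝ} : u ∈ hq.crit ↔ u ∈ Icc (0 : ℝ) 1 ∧ derivWithin q (Icc 0 1) u = 0 := by
  simp [crit]

/-- Rolle's theorem: equal values at two points of a gap would produce a critical point between
them. -/
theorem injOn_gap (j : ℕ) : InjOn q (gap hq.crit j) := by
  have aux : ∀ a ∈ gap hq.crit j, ∀ b ∈ gap hq.crit j, a < b → q a ≠ q b := by
    intro a ha b hb hab heq
    have hsub : Icc a b ⊆ Icc 0 1 := Icc_subset_Icc ha.1.1.1 hb.1.1.2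
    obtain ⟨c, hc, hdc⟩ := exists_deriv_eq_zero hab (hq.diff.continuousOn.mono hsub) heq
    have hcg := gap_eq_of_mem_Ioo ha hb hc
    refine hcg.1.2 (hq.mem_crit.2 ⟨hcg.1.1, ?_⟩)
    rw [derivWithin_of_mem_nhds, hdc]
    exact Icc_mem_nhds (ha.1.1.1.trans_lt hc.1) (hc.2.trans_le hb.1.1.2)
  intro a ha b hb heq
  rcases lt_trichotomy a b with h | h | h
  · exact absurd heq (aux a ha b hb h)
  · exact h
  · exact absurd heq.symm (aux b hb a ha h)

/-- Each gap contains at most one root, and the critical roots are finite in number. -/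
theorem finite_roots (y : ℝ) : {u | u ∈ Icc (0 : ℝ) 1 ∧ q u = y}.Finite := by
  have hfin : ({u | u ∈ Icc (0 : ℝ) 1 ∧ q u = y} \ hq.crit).Finite := by
    refine Set.Finite.of_injOn (f := fun u => (hq.crit.filter (· < u)).card)
      (t := (Finset.range (hq.crit.card + 1) : Set ℕ)) (fun u _ => ?_) ?_ (Finset.finite_toSet _)
    · exact Finset.mem_coe.2 (Finset.mem_range.2 (Nat.lt_succ_of_le (Finset.card_filter_le _ _)))
    · intro u hu v hv huv
      exact hq.injOn_gap _ ⟨⟨hu.1.1, hu.2⟩, rfl⟩ ⟨⟨hv.1.1, hv.2⟩, huv.symm⟩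
        (hu.1.2.trans hv.1.2.symm)
  exact (hfin.union hq.crit.finite_toSet).subset fun u hu => by
    by_cases h : u ∈ (hq.crit : Set ℝ)
    · exact Or.inr h
    · exact Or.inl ⟨hu, h⟩

theorem unif_level_eq_zero (y : ℝ) : unif {u | q u = y} = 0 := by
  refine le_antisymm ((measure_mono_ae ?_).trans ((hq.finite_roots y).measure_zero unif).le) bot_le
  filter_upwards [ae_restrict_mem measurableSet_Icc] with u hu h
  exact ⟨hu, h⟩

theorem hasDerivWithinAt_gap (j : ℕ) (u : ℝ) (hu : u ∈ gap hq.crit j) :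
    HasDerivWithinAt q (derivWithin q (Icc 0 1) u) (gap hq.crit j) u :=
  ((hq.diff u hu.1.1).hasDerivWithinAt).mono (gap_subset _ _)

theorem abs_deriv_mul_inv (h : ℝ → ℝ) {j : ℕ} {u : ℝ} (hu : u ∈ gap hq.crit j) :
    |derivWithin q (Icc 0 1) u| •
      (fun y => h (Function.invFunOn q (gap hq.crit j) y) /
        |derivWithin q (Icc 0 1) (Function.invFunOn q (gap hq.crit j) y)|) (q u) = h u := by
  have hne : derivWithin q (Icc 0 1) u ≠ 0 := fun h0 => hu.1.2 (hq.mem_crit.2 ⟨hu.1.1, h0⟩)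
  simp only [(hq.injOn_gap j).leftInvOn_invFunOn hu, smul_eq_mul]
  have : |derivWithin q (Icc 0 1) u| ≠ 0 := abs_ne_zero.2 hne
  field_simp

/-- Off the finitely many critical values each gap contributes its unique root, if any. There a
value fails to be regular only when it has no root, and both sides are then zero. -/
theorem rootSum_eq_sum (h : ℝ → ℝ) {y : ℝ} (hy : y ∉ q '' hq.crit) :
    rootSum q h y = ∑ j ∈ Finset.range (hq.crit.card + 1), Set.indicator (q '' gap hq.crit j)
      (fun y => h (Function.invFunOn q (gap hq.crit j) y) /
        |derivWithin q (Icc 0 1) (Function.invFunOn q (gap hq.crit j) y)|) y := by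
  classical
  have hR := hq.finite_roots y
  have hcrit : ∀ u ∈ {u | u ∈ Icc (0 : ℝ) 1 ∧ q u = y}, u ∉ hq.crit := fun u hu hc =>
    hy ⟨u, hc, hu.2⟩
  have h1 : rootSum q h y = ∑ᶠ u ∈ {u | u ∈ Icc (0 : ℝ) 1 ∧ q u = y},
      h u / |derivWithin q (Icc 0 1) u| := by
    rw [rootSum]
    split_ifs with hc
    · rfl
    · rw [not_and] at hc
      have hemp : {u | u ∈ Icc (0 : ℝ) 1 ∧ q u = y} = ∅ := by
        by_contra hne
        refine hc (nonempty_iff_ne_empty.2 hne) fun u hu h0 => ?_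
        exact hcrit u hu (hq.mem_crit.2 ⟨hu.1, h0⟩)
      rw [hemp, finsum_mem_empty]
  rw [h1, finsum_mem_eq_finite_toFinset_sum _ hR,
    ← Finset.sum_fiberwise_of_maps_to (t := Finset.range (hq.crit.card + 1))
      (g := fun u => (hq.crit.filter (· < u)).card)
      (fun u _ => Finset.mem_range.2 (Nat.lt_succ_of_le (Finset.card_filter_le _ _)))]
  refine Finset.sum_congr rfl fun j _ => ?_
  have hmem : ∀ u, u ∈ hR.toFinset.filter (fun u => (hq.crit.filter (· < u)).card = j) ↔
      u ∈ gap hq.crit j ∧ q u = y := fun u => by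
    rw [Finset.mem_filter, Set.Finite.mem_toFinset]
    constructor
    · rintro ⟨hu, hj⟩
      exact ⟨⟨⟨hu.1, hcrit u hu⟩, hj⟩, hu.2⟩
    · rintro ⟨hu, hj⟩
      exact ⟨⟨hu.1.1, hj⟩, hu.2⟩
  by_cases hyj : y ∈ q '' gap hq.crit j
  · rw [indicator_of_mem hyj]
    obtain ⟨v, hv, rfl⟩ := hyj
    have hs : hR.toFinset.filter (fun u => (hq.crit.filter (· < u)).card = j) = {v} := by
      ext u
      rw [hmem, Finset.mem_singleton]
      constructor
      · rintro ⟨hu, huv⟩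
        exact hq.injOn_gap j hu hv huv
      · rintro rfl
        exact ⟨hv, rfl⟩
    rw [hs, Finset.sum_singleton, (hq.injOn_gap j).leftInvOn_invFunOn hv]
  · rw [indicator_of_notMem hyj]
    refine Finset.sum_eq_zero fun u hu => ?_
    rw [hmem] at hu
    exact absurd ⟨u, hu.1, hu.2⟩ hyj

theorem ae_notMem_crit : ∀ᵐ y ∂(volume : Measure ℝ), y ∉ q '' hq.crit :=
  measure_eq_zero_iff_ae_notMem.1 ((hq.crit.finite_toSet.image q).measure_zero _)

theorem integrable_gap_term {h : ℝ → ℝ} (hh : Integrable h unif) (j : ℕ) :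
    IntegrableOn (fun y => h (Function.invFunOn q (gap hq.crit j) y) /
        |derivWithin q (Icc 0 1) (Function.invFunOn q (gap hq.crit j) y)|)
      (q '' gap hq.crit j) := by
  rw [integrableOn_image_iff_integrableOn_abs_deriv_smul (measurableSet_gap _ j)
    (hq.hasDerivWithinAt_gap j) (hq.injOn_gap j)]
  exact (IntegrableOn.mono_set hh (gap_subset hq.crit j)).congr_fun
    (fun u hu => (hq.abs_deriv_mul_inv h hu).symm) (measurableSet_gap _ j)

theorem measurableSet_image_gap (j : ℕ) : MeasurableSet (q '' gap hq.crit j) :=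
  (measurableSet_gap _ j).image_of_continuousOn_injOn
    (hq.diff.continuousOn.mono (gap_subset _ _)) (hq.injOn_gap j)

theorem integrable_rootSum {h : ℝ → ℝ} (hh : Integrable h unif) : Integrable (rootSum q h) := by
  have : Integrable (fun y => ∑ j ∈ Finset.range (hq.crit.card + 1),
      Set.indicator (q '' gap hq.crit j)
        (fun y => h (Function.invFunOn q (gap hq.crit j) y) /
          |derivWithin q (Icc 0 1) (Function.invFunOn q (gap hq.crit j) y)|) y) :=
    integrable_finsetSum _ fun j _ =>
      (integrable_indicator_iff (hq.measurableSet_image_gap j)).2 (hq.integrable_gap_term hh j)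
  refine this.congr ?_
  filter_upwards [hq.ae_notMem_crit] with y hy
  exact (hq.rootSum_eq_sum h hy).symm

/-- The area formula for a curve with finitely many critical points. -/
theorem integral_rootSum {h : ℝ → ℝ} (hh : Integrable h unif) :
    ∫ y, rootSum q h y = ∫ u, h u ∂unif := by
  have hae : rootSum q h =ᵐ[volume] fun y => ∑ j ∈ Finset.range (hq.crit.card + 1),
      Set.indicator (q '' gap hq.crit j)
        (fun y => h (Function.invFunOn q (gap hq.crit j) y) /
          |derivWithin q (Icc 0 1) (Function.invFunOn q (gap hq.crit j) y)|) y := by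
    filter_upwards [hq.ae_notMem_crit] with y hy
    exact hq.rootSum_eq_sum h hy
  rw [integral_congr_ae hae, integral_finsetSum _ fun j _ =>
      (integrable_indicator_iff (hq.measurableSet_image_gap j)).2 (hq.integrable_gap_term hh j),
    integral_unif_eq_sum_gap hq.crit hh]
  refine Finset.sum_congr rfl fun j _ => ?_
  rw [integral_indicator (hq.measurableSet_image_gap j),
    integral_image_eq_integral_abs_deriv_smul (measurableSet_gap _ j)
      (hq.hasDerivWithinAt_gap j) (hq.injOn_gap j)]
  exact setIntegral_congr_fun (measurableSet_gap _ j) fun u hu => hq.abs_deriv_mul_inv h hu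

theorem rootSum_comp_mul (φ h : ℝ → ℝ) (y : ℝ) :
    rootSum q (fun u => φ (q u) * h u) y = φ y * rootSum q h y := by
  rw [rootSum, rootSum]
  split_ifs with hc
  · rw [finsum_mem_eq_finite_toFinset_sum _ (hq.finite_roots y),
      finsum_mem_eq_finite_toFinset_sum _ (hq.finite_roots y), Finset.mul_sum]
    refine Finset.sum_congr rfl fun u hu => ?_
    have hu' : q u = y := ((Set.Finite.mem_toFinset _).1 hu).2
    rw [hu', mul_div_assoc]
  · rw [mul_zero]

theorem integral_mul_rootSum {φ h : ℝ → ℝ} (hh : Integrable (fun u => φ (q u) * h u) unif) :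
    ∫ y, φ y * rootSum q h y = ∫ u, φ (q u) * h u ∂unif := by
  rw [← hq.integral_rootSum hh]
  simp only [hq.rootSum_comp_mul]

theorem rootSum_one_nonneg (y : ℝ) : 0 ≤ rootSum q (fun _ => 1) y := by
  rw [rootSum]
  split_ifs
  · rw [finsum_mem_eq_finite_toFinset_sum _ (hq.finite_roots y)]
    exact Finset.sum_nonneg fun u _ => by positivity
  · exact le_rfl

/-- At regular values the density is positive and cancels; elsewhere both sides vanish, so the
convention `1 / 0 = 0` does no harm. -/
theorem rootSum_one_div_mul (h : ℝ → ℝ) (y : ℝ) :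
    rootSum q (fun _ => 1) y * (1 / rootSum q (fun _ => 1) y * rootSum q h y) = rootSum q h y := by
  by_cases hc : {u | u ∈ Icc (0 : ℝ) 1 ∧ q u = y}.Nonempty ∧
      ∀ u ∈ {u | u ∈ Icc (0 : ℝ) 1 ∧ q u = y}, derivWithin q (Icc 0 1) u ≠ 0
  · have hpos : 0 < rootSum q (fun _ => 1) y := by
      rw [rootSum, if_pos hc, finsum_mem_eq_finite_toFinset_sum _ (hq.finite_roots y)]
      refine Finset.sum_pos (fun u hu => ?_) ?_
      · have := hc.2 u (by simpa using hu)
        positivity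
      · simpa using hc.1
    field_simp
  · have : rootSum q h y = 0 := by rw [rootSum, if_neg hc]
    rw [this, mul_zero, mul_zero]

theorem aemeasurable : AEMeasurable q unif :=
  hq.diff.continuousOn.aemeasurable measurableSet_Icc

/-- This is the area formula with an indicator function as weight. -/
theorem map_eq_withDensity :
    unif.map q = volume.withDensity fun y => ENNReal.ofReal (rootSum q (fun _ => 1) y) := by
  have hf : Integrable (rootSum q fun _ => 1) := hq.integrable_rootSum (integrable_const 1)
  ext A hA
  have hpre := hq.aemeasurable.nullMeasurableSet_preimage hA
  have h1 : ∀ u, Set.indicator A (fun _ => (1 : ℝ)) (q u) * 1 =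
      Set.indicator (q ⁻¹' A) (fun _ => (1 : ℝ)) u := fun u => by
    rw [mul_one]
    rfl
  have h2 := hq.integral_mul_rootSum (φ := Set.indicator A fun _ => 1) (h := fun _ => 1) (by
    simp only [h1]
    exact (integrable_const (1 : ℝ)).indicator₀ hpre)
  simp only [h1] at h2
  rw [integral_indicator₀ hpre] at h2
  have h3 : ∀ y, Set.indicator A (fun _ => (1 : ℝ)) y * rootSum q (fun _ => 1) y =
      Set.indicator A (rootSum q fun _ => 1) y := fun y => by
    by_cases hy : y ∈ A <;> simp [hy]
  simp only [h3] at h2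
  rw [integral_indicator hA] at h2
  rw [Measure.map_apply_of_aemeasurable hq.aemeasurable hA, withDensity_apply _ hA,
    ← ofReal_integral_eq_lintegral_ofReal hf.integrableOn (ae_of_all _ hq.rootSum_one_nonneg), h2]
  simp only [integral_const, smul_eq_mul, mul_one, measureReal_restrict_apply_univ]
  rw [ofReal_measureReal]

end TameCurve

/-! ### Box-kernel bounds and integral formulas for the smoothed derivatives. -/

theorem measurable_boxKernel (δ : ℝ) : Measurable (boxKernel δ) :=
  measurable_const.indicator (measurableSet_le (by fun_prop) measurable_const)

theorem abs_boxKernel_le {δ : ℝ} (hδ : 0 < δ) (v : ℝ) : |boxKernel δ v| ≤ 1 / (2 * δ) := by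
  rw [boxKernel, Set.indicator]
  split_ifs
  · rw [abs_of_pos (by positivity)]
  · rw [abs_zero]
    positivity

theorem integrable_boxKernel_mul {δ : ℝ} (hδ : 0 < δ) {r h : ℝ → ℝ} (hr : AEMeasurable r unif)
    (hh : Integrable h unif) (z : ℝ) : Integrable (fun u => boxKernel δ (z - r u) * h u) unif :=
  hh.bdd_mul ((measurable_boxKernel δ).comp_aemeasurable
    (aemeasurable_const.sub hr)).aestronglyMeasurable (ae_of_all _ fun _ => abs_boxKernel_le hδ _)

namespace TameCurve

variable {q h : ℝ → ℝ} {C δ : ℝ}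

theorem smooth_neg_rootSum (hq : TameCurve q) (hh : Integrable h unif) (hδ : 0 < δ) (z : ℝ) :
    smooth univ δ (fun y => -rootSum q h y) z = -∫ u, boxKernel δ (z - q u) * h u ∂unif := by
  rw [← hq.integral_mul_rootSum (φ := fun y => boxKernel δ (z - y))
    (integrable_boxKernel_mul hδ hq.aemeasurable hh z), smooth, setIntegral_univ, ← integral_neg]
  simp only [mul_neg]

/-- Since `u = F(q^*(u))`, the integrand is a function of `q^*(u)`, which has the law of `q`. The
density `f` of that law cancels `1 / f`, and the area formula returns to an integral over `u`. -/
theorem smooth_rootSum_div_quantU (hq : TameCurve q) (hb : BddCurve q C) (hh : Integrable h unif)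
    (hδ : 0 < δ) (z : ℝ) :
    smooth (Icc 0 1) δ (fun u => 1 / rootSum q (fun _ => 1) (quantU q u) *
      rootSum q h (quantU q u)) z = ∫ u, boxKernel δ (z - cdfU q (q u)) * h u ∂unif := by
  set f := rootSum q fun _ => 1 with hf
  have hfi : Integrable f := hq.integrable_rootSum (integrable_const 1)
  have hri : Integrable (rootSum q h) := hq.integrable_rootSum hh
  set Φ : ℝ → ℝ := fun y => boxKernel δ (z - cdfU q y) * (1 / f y * rootSum q h y) with hΦ
  have hΦm : AEMeasurable Φ volume :=
    ((measurable_boxKernel δ).comp (measurable_const.sub hb.measurable_cdfU)).aemeasurable.mul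
      ((aemeasurable_const.div hfi.aestronglyMeasurable.aemeasurable).mul
        hri.aestronglyMeasurable.aemeasurable)
  have hΦm' : AEStronglyMeasurable Φ (unif.map q) := by
    rw [hq.map_eq_withDensity]
    exact (hΦm.mono_ac (withDensity_absolutelyContinuous _ _)).aestronglyMeasurable
  have h1 : smooth (Icc 0 1) δ (fun u => 1 / f (quantU q u) * rootSum q h (quantU q u)) z =
      ∫ u, Φ (quantU q u) ∂unif := by
    change ∫ u, boxKernel δ (z - u) * (1 / f (quantU q u) * rootSum q h (quantU q u)) ∂unif = _
    refine integral_congr_ae ?_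
    rw [unif_eq_restrict_Ioc]
    filter_upwards [ae_restrict_mem measurableSet_Ioc] with u hu
    simp only [hΦ]
    rw [hb.cdfU_quantU hq.unif_level_eq_zero hu]
  have h2 : ∫ u, Φ (quantU q u) ∂unif = ∫ y, Φ y ∂(unif.map q) := by
    rw [← hb.map_quantU, integral_map hb.aemeasurable_quantU]
    rwa [hb.map_quantU]
  have h3 : ∫ y, Φ y ∂(unif.map q) = ∫ y, boxKernel δ (z - cdfU q y) * rootSum q h y := by
    rw [hq.map_eq_withDensity, integral_withDensity_eq_integral_toReal_smul₀
      hfi.aestronglyMeasurable.aemeasurable.ennreal_ofReal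
      (ae_of_all _ fun _ => ENNReal.ofReal_lt_top)]
    refine integral_congr_ae (ae_of_all _ fun y => ?_)
    simp only [hΦ]
    rw [ENNReal.toReal_ofReal (hq.rootSum_one_nonneg y), smul_eq_mul, mul_left_comm,
      hq.rootSum_one_div_mul]
  rw [h1, h2, h3]
  exact hq.integral_mul_rootSum (φ := fun y => boxKernel δ (z - cdfU q y))
    (integrable_boxKernel_mul hδ hb.aemeasurable_cdfU_comp hh z)

end TameCurve

variable {d : ℕ} {X : Set (Cov d)}

/-! ### Uniform smallness of tubes around level sets -/

/-- Continuity from above makes a thin tube around a null level set small; uniform continuity of `Q`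
carries this to nearby `(x, y)`, and compactness gives one radius for all. -/
theorem exists_uniform_tube (hX : IsCompact X) {Q : ℝ → Cov d → ℝ}
    (hQ : ContinuousOn (fun p : ℝ × Cov d => Q p.1 p.2) (UX X))
    (hna : ∀ x ∈ X, ∀ y, unif {u | Q u x = y} = 0) {η : ℝ} (hη : 0 < η) :
    ∃ ε₀ > 0, ∀ ε ≤ ε₀, ∀ x ∈ X, ∀ y, unif.real {u | |Q u x - y| ≤ ε} ≤ η := by
  have hUX : IsCompact (UX X) := isCompact_Icc.prod hX
  obtain ⟨M, hM⟩ := hUX.exists_bound_of_continuousOn hQ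
  have hslice : ∀ x ∈ X, AEMeasurable (fun u => Q u x) unif := fun x hx =>
    (hQ.comp (f := fun u : ℝ => (u, x)) (by fun_prop)
      (fun u hu => ⟨hu, hx⟩)).aemeasurable measurableSet_Icc
  have hmono : ∀ {x y ε ε' : ℝ}, ε ≤ ε' → |x - y| ≤ ε → |x - y| ≤ ε' := fun h h' => h'.trans h
  have key : ∃ ε₀ > 0, ∀ p ∈ X ×ˢ Icc (-(M + 1)) (M + 1),
      unif.real {u | |Q u p.1 - p.2| ≤ ε₀} ≤ η := by
    refine (hX.prod isCompact_Icc).induction_on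
      (p := fun S => ∃ ε₀ > 0, ∀ p ∈ S, unif.real {u | |Q u p.1 - p.2| ≤ ε₀} ≤ η)
      ⟨1, one_pos, fun p hp => hp.elim⟩ ?_ ?_ ?_
    · rintro s t hst ⟨ε, hε, h⟩
      exact ⟨ε, hε, fun p hp => h p (hst hp)⟩
    · rintro s t ⟨ε, hε, h⟩ ⟨ε', hε', h'⟩
      refine ⟨min ε ε', lt_min hε hε', fun p hp => ?_⟩
      rcases hp with hp | hp
      · exact (measureReal_mono fun u hu => hmono (min_le_left _ _) hu).trans (h p hp)
      · exact (measureReal_mono fun u hu => hmono (min_le_right _ _) hu).trans (h' p hp)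
    · rintro ⟨x₀, y₀⟩ ⟨hx₀, -⟩
      -- The factor `3` pays for the tube radius, the change from `x₀` to `x` and the change from
      -- `y₀` to `y`, one `ε` each.
      have hlim : Tendsto (fun n : ℕ => unif {u | |Q u x₀ - y₀| ≤ 3 * (1 / ((n : ℝ) + 1))}) atTop
          (𝓝 0) := by
        have hInter : ⋂ n : ℕ, {u | |Q u x₀ - y₀| ≤ 3 * (1 / ((n : ℝ) + 1))} =
            {u | Q u x₀ = y₀} := by
          ext u
          rw [mem_iInter]
          constructor
          · intro h
            have h1 : |Q u x₀ - y₀| ≤ 3 * 0 :=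
              ge_of_tendsto' (tendsto_one_div_add_atTop_nhds_zero_nat.const_mul 3) h
            rw [mul_zero] at h1
            exact sub_eq_zero.1 (abs_nonpos_iff.1 h1)
          · intro h n
            have h1 : Q u x₀ = y₀ := h
            change |Q u x₀ - y₀| ≤ _
            rw [h1, sub_self, abs_zero]
            positivity
        rw [← hna x₀ hx₀ y₀, ← hInter]
        refine tendsto_measure_iInter_atTop (fun n => ?_) ?_ ⟨0, measure_ne_top _ _⟩
        · exact (hslice x₀ hx₀).nullMeasurableSet_preimage
            (s := {z | |z - y₀| ≤ 3 * (1 / ((n : ℝ) + 1))})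
            (measurableSet_le (by fun_prop) measurable_const)
        · intro m n hmn u hu
          refine hmono ?_ hu
          have := Nat.one_div_le_one_div (α := ℝ) hmn
          linarith
      obtain ⟨n, hn⟩ := (hlim.eventually_lt_const (ENNReal.ofReal_pos.2 hη)).exists
      set ε : ℝ := 1 / ((n : ℝ) + 1) with hε
      have hεpos : 0 < ε := Nat.one_div_pos_of_nat
      have huc := hUX.uniformContinuousOn_of_continuous hQ
      rw [Metric.uniformContinuousOn_iff] at huc
      obtain ⟨δ, hδ, hQδ⟩ := huc ε hεpos
      refine ⟨(X ×ˢ Icc (-(M + 1)) (M + 1)) ∩ (Metric.ball x₀ δ ×ˢ Metric.ball y₀ ε),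
        inter_mem_nhdsWithin _ (prod_mem_nhds (Metric.ball_mem_nhds _ hδ)
          (Metric.ball_mem_nhds _ hεpos)), ε, hεpos, ?_⟩
      rintro ⟨x, y⟩ ⟨⟨hx, -⟩, hxb, hyb⟩
      refine ENNReal.toReal_le_of_le_ofReal hη.le (le_trans (measure_mono_ae ?_) hn.le)
      filter_upwards [ae_restrict_mem measurableSet_Icc] with u hu h
      have h1 : dist (Q u x) (Q u x₀) < ε := hQδ (u, x) ⟨hu, hx⟩ (u, x₀) ⟨hu, hx₀⟩ (by
        rw [Prod.dist_eq, dist_self]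
        exact max_lt hδ hxb)
      have h2 : |Q u x - y| ≤ ε := h
      have h3 : dist y y₀ < ε := hyb
      rw [Real.dist_eq, abs_lt] at h1 h3
      rw [abs_le] at h2
      exact abs_le.2 ⟨by linarith [h1.2, h2.1, h3.1], by linarith [h1.1, h2.2, h3.2]⟩
  obtain ⟨ε₀, hε₀, h⟩ := key
  refine ⟨min ε₀ 1, lt_min hε₀ one_pos, fun ε hε x hx y => ?_⟩
  by_cases hy : y ∈ Icc (-(M + 1)) (M + 1)
  · exact (measureReal_mono fun u hu => hmono (hε.trans (min_le_left _ _)) hu).trans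
      (h (x, y) ⟨hx, hy⟩)
  -- As `|Q| ≤ M` and the radius is at most `1`, no point of `[0,1]` lies in a tube around a level
  -- beyond `M + 1`.
  · have hzero : unif {u | |Q u x - y| ≤ ε} = 0 := by
      refine le_antisymm ((measure_mono_ae (t := ∅) ?_).trans (by simp)) bot_le
      filter_upwards [ae_restrict_mem measurableSet_Icc] with u hu h'
      refine hy ?_
      have h1 := hM (u, x) ⟨hu, hx⟩
      have h2 : |Q u x - y| ≤ ε := h'
      have h3 := hε.trans (min_le_right _ _)
      rw [Real.norm_eq_abs, abs_le] at h1
      rw [abs_le] at h2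
      simp only at h1
      constructor <;> linarith [h1.1, h1.2, h2.1, h2.2]
    rw [Measure.real, hzero]
    simpa using hη.le

/-! ### Joint measurability -/

/-- The extension by zero of a function on `UX`. -/
def extCurve (f : UX X → ℝ) : ℝ × Cov d → ℝ := Function.extend Subtype.val f 0

theorem extCurve_apply (f : UX X → ℝ) {u : ℝ} {x : Cov d} (h : (u, x) ∈ UX X) :
    extCurve f (u, x) = f ⟨(u, x), h⟩ :=
  Subtype.val_injective.extend_apply f 0 ⟨(u, x), h⟩

theorem measurable_extCurve (hX : IsCompact X) {f : UX X → ℝ} (hf : Measurable f) :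
    Measurable (extCurve f) :=
  (MeasurableEmbedding.subtype_coe
    (isCompact_Icc.prod hX).measurableSet).measurable_extend hf measurable_zero

theorem measurable_integral {S : Type*} [MeasurableSpace S] {ν : Measure ℝ} [SFinite ν]
    {K : S → ℝ → ℝ} (hK : Measurable (Function.uncurry K)) : Measurable fun s => ∫ u, K s u ∂ν :=
  hK.stronglyMeasurable.integral_prod_right.measurable

/-- Joint measurability includes the bandwidth, as is needed when `δ` belongs to the index set. -/
theorem measurable_boxKernel_uncurry : Measurable fun p : ℝ × ℝ => boxKernel p.1 p.2 := by
  have : (fun p : ℝ × ℝ => boxKernel p.1 p.2) =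
      Set.indicator {p : ℝ × ℝ | |p.2| ≤ p.1} fun p => 1 / (2 * p.1) := by
    ext p
    simp [boxKernel, Set.indicator]
  rw [this]
  exact Measurable.indicator (by fun_prop) (measurableSet_le (by fun_prop) (by fun_prop))

theorem cdfU_congr {q r : ℝ → ℝ} (h : EqOn q r (Icc 0 1)) : cdfU q = cdfU r := by
  ext y
  refine setIntegral_congr_fun measurableSet_Icc fun u hu => ?_
  simp only [Set.indicator, mem_ofPred_eq, h hu]

theorem quantU_congr {q r : ℝ → ℝ} (h : EqOn q r (Icc 0 1)) : quantU q = quantU r := by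
  ext u
  rw [quantU, quantU, cdfU_congr h]

theorem measurable_cdfU_uncurry {R : ℝ × Cov d → ℝ} (hR : Measurable R) :
    Measurable fun p : ℝ × Cov d => cdfU (fun u => R (u, p.2)) p.1 := by
  refine measurable_integral (S := ℝ × Cov d)
    (K := fun p u => Set.indicator {u | R (u, p.2) ≤ p.1} (fun _ => (1 : ℝ)) u) ?_
  have : (Function.uncurry fun (p : ℝ × Cov d) u =>
      Set.indicator {u | R (u, p.2) ≤ p.1} (fun _ => (1 : ℝ)) u) =
      Set.indicator {t : (ℝ × Cov d) × ℝ | R (t.2, t.1.2) ≤ t.1.1} fun _ => 1 := by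
    ext p
    simp [Function.uncurry, Set.indicator]
  rw [this]
  exact measurable_const.indicator (measurableSet_le (by fun_prop) (by fun_prop))

-- The Galois connection rewrites sublevel sets of the quantile function as `{u ≤ F(y|x)}`, avoiding
-- an uncountable infimum. The cut-off removes `u = 0`, where the connection fails.
open Classical in
theorem measurable_quantU_uncurry (hX : IsCompact X) {R : ℝ × Cov d → ℝ} (hR : Measurable R) {C : ℝ}
    (hC : ∀ x ∈ X, BddCurve (fun u => R (u, x)) C) :
    Measurable fun p : ℝ × Cov d =>
      if p ∈ Ioc (0 : ℝ) 1 ×ˢ X then quantU (fun u => R (u, p.2)) p.1 else 0 := by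
  refine measurable_of_Iic fun y => ?_
  have : (fun p : ℝ × Cov d =>
      if p ∈ Ioc (0 : ℝ) 1 ×ˢ X then quantU (fun u => R (u, p.2)) p.1 else 0) ⁻¹' Iic y =
      (Ioc (0 : ℝ) 1 ×ˢ X ∩ {p | p.1 ≤ cdfU (fun u => R (u, p.2)) y}) ∪
        ((Ioc (0 : ℝ) 1 ×ˢ X)ᶜ ∩ {_p | 0 ≤ y}) := by
    ext p
    by_cases hp : p ∈ Ioc (0 : ℝ) 1 ×ˢ X
    · simp only [mem_preimage, mem_Iic, mem_union, mem_inter_iff, hp, true_and,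
        mem_compl_iff, not_true, false_and, or_false, mem_ofPred_eq]
      exact ((hC p.2 hp.2).le_cdfU_iff hp.1 y).symm
    · simp only [mem_preimage, mem_Iic, mem_union, mem_inter_iff, hp, false_and,
        mem_compl_iff, not_false_eq_true, true_and, false_or, if_false, mem_ofPred_eq]
  rw [this]
  have hm : MeasurableSet (Ioc (0 : ℝ) 1 ×ˢ X) := measurableSet_Ioc.prod hX.measurableSet
  have hF : Measurable fun p : ℝ × Cov d => cdfU (fun u => R (u, p.2)) y :=
    (measurable_cdfU_uncurry hR).comp (g := fun p : ℝ × Cov d => cdfU (fun u => R (u, p.2)) p.1)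
      (f := fun p : ℝ × Cov d => (y, p.2)) (by fun_prop)
  exact (hm.inter (measurableSet_le measurable_fst hF)).union (hm.compl.inter (.const _))

theorem abs_smooth_le {A : Set ℝ} {δ C : ℝ} (hδ : 0 < δ) {f : ℝ → ℝ} (hf : ∀ y ∈ A, |f y| ≤ C)
    (hC : 0 ≤ C) (z : ℝ) : |smooth A δ f z| ≤ C := by
  rw [smooth_eq, abs_mul, abs_of_pos (by positivity : 0 < 1 / (2 * δ))]
  have hvol : volume (A ∩ Icc (z - δ) (z + δ)) ≤ ENNReal.ofReal (2 * δ) :=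
    (measure_mono inter_subset_right).trans (by rw [Real.volume_Icc]; ring_nf; rfl)
  have h1 := norm_setIntegral_le_of_norm_le_const (μ := volume) (f := f)
    (hvol.trans_lt ENNReal.ofReal_lt_top) fun y hy => hf y hy.1
  have h2 : volume.real (A ∩ Icc (z - δ) (z + δ)) ≤ 2 * δ :=
    ENNReal.toReal_le_of_le_ofReal (by positivity) hvol
  calc 1 / (2 * δ) * |∫ y in A ∩ Icc (z - δ) (z + δ), f y| ≤ 1 / (2 * δ) * (C * (2 * δ)) := by
        refine mul_le_mul_of_nonneg_left (h1.trans ?_) (by positivity)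
        exact mul_le_mul_of_nonneg_left h2 hC
    _ = C := by field_simp

/-! ### Index sets of smoothed processes -/

/-- A measurable parametrisation of evaluation points `(z, x)` and bandwidths `δ`, with the
bandwidths bounded away from zero. -/
structure SmoothIndex (X : Set (Cov d)) (S : Type*) [MeasurableSpace S] where
  /-- the point at which the smoothed curve is evaluated -/
  z : S → ℝ
  /-- the covariate -/
  x : S → Cov d
  /-- the bandwidth -/
  δ : S → ℝ
  /-- a lower bound of the bandwidths -/
  lo : ℝ
  measurable_z : Measurable z
  measurable_x : Measurable x
  measurable_δ : Measurable δ
  x_mem : ∀ s, x s ∈ X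
  lo_pos : 0 < lo
  lo_le : ∀ s, lo ≤ δ s

theorem IsBddMeas.sub {T : Type*} [MeasurableSpace T] {f g : T → ℝ} (hf : IsBddMeas f)
    (hg : IsBddMeas g) : IsBddMeas fun t => f t - g t := by
  obtain ⟨C, hC⟩ := hf.2
  obtain ⟨D, hD⟩ := hg.2
  exact ⟨hf.1.sub hg.1, C + D, fun t => (abs_sub _ _).trans (add_le_add (hC t) (hD t))⟩

theorem IsBddMeas.const_mul {T : Type*} [MeasurableSpace T] {f : T → ℝ} (hf : IsBddMeas f)
    (c : ℝ) : IsBddMeas fun t => c * f t := by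
  obtain ⟨C, hC⟩ := hf.2
  refine ⟨hf.1.const_mul c, |c| * C, fun t => ?_⟩
  rw [abs_mul]
  exact mul_le_mul_of_nonneg_left (hC t) (abs_nonneg c)

theorem extCurve_slice_eqOn {R : ℝ → Cov d → ℝ} {x : Cov d} (hx : x ∈ X) :
    EqOn (fun u => R u x) (fun u => extCurve (fun p : UX X => R p.1.1 p.1.2) (u, x)) (Icc 0 1) :=
  fun u hu => (extCurve_apply (fun p : UX X => R p.1.1 p.1.2) (u := u) ⟨hu, hx⟩).symm

theorem IsBddMeas.exists_bddCurve (hX : IsCompact X) {R : ℝ → Cov d → ℝ}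
    (hR : IsBddMeas fun p : UX X => R p.1.1 p.1.2) :
    ∃ C, ∀ x ∈ X, BddCurve (fun u => R u x) C := by
  obtain ⟨C, hC⟩ := hR.2
  refine ⟨C, fun x hx => ⟨?_, fun u hu => hC ⟨(u, x), hu, hx⟩⟩⟩
  have h : Measurable fun u : ℝ => extCurve (fun p : UX X => R p.1.1 p.1.2) (u, x) :=
    (measurable_extCurve hX hR.1).comp (by fun_prop)
  refine h.aemeasurable.congr ?_
  filter_upwards [ae_restrict_mem measurableSet_Icc] with u hu
  exact (extCurve_slice_eqOn hx hu).symm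

namespace SmoothIndex

variable {S : Type*} [MeasurableSpace S] (I : SmoothIndex X S)

theorem δ_pos (s : S) : 0 < I.δ s := I.lo_pos.trans_le (I.lo_le s)

theorem measurable_kernel {r : S × ℝ → ℝ} (hr : Measurable r) :
    Measurable fun t : S × ℝ => boxKernel (I.δ t.1) (I.z t.1 - r t) :=
  measurable_boxKernel_uncurry.comp (f := fun t : S × ℝ => (I.δ t.1, I.z t.1 - r t))
    ((I.measurable_δ.comp measurable_fst).prodMk ((I.measurable_z.comp measurable_fst).sub hr))

theorem isBddMeas_smoothY (hX : IsCompact X) {R : ℝ → Cov d → ℝ}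
    (hR : IsBddMeas fun p : UX X => R p.1.1 p.1.2) :
    IsBddMeas fun s => smoothY (I.δ s) (distr R) (I.z s) (I.x s) := by
  set E := extCurve (fun p : UX X => R p.1.1 p.1.2) with hE
  have hEm : Measurable E := measurable_extCurve hX hR.1
  obtain ⟨C, hC⟩ := hR.exists_bddCurve hX
  constructor
  · have h1 : (fun s => smoothY (I.δ s) (distr R) (I.z s) (I.x s)) = fun s =>
        ∫ y in univ, boxKernel (I.δ s) (I.z s - y) * cdfU (fun u => E (u, I.x s)) y := by
      ext s
      rw [← cdfU_congr (extCurve_slice_eqOn (R := R) (I.x_mem s))]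
      rfl
    rw [h1]
    refine measurable_integral ((I.measurable_kernel measurable_snd).mul ?_)
    exact (measurable_cdfU_uncurry hEm).comp (f := fun t : S × ℝ => (t.2, I.x t.1))
      (measurable_snd.prodMk (I.measurable_x.comp measurable_fst))
  · refine ⟨1, fun s => abs_smooth_le (I.δ_pos s) (fun y _ => ?_) zero_le_one _⟩
    have hc := hC (I.x s) (I.x_mem s)
    exact abs_le.2 ⟨le_trans (by norm_num) (hc.cdfU_nonneg y), hc.cdfU_le_one y⟩

theorem isBddMeas_smoothU (hX : IsCompact X) {R : ℝ → Cov d → ℝ}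
    (hR : IsBddMeas fun p : UX X => R p.1.1 p.1.2) :
    IsBddMeas fun s => smoothU (I.δ s) (rearr R) (I.z s) (I.x s) := by
  classical
  set E := extCurve (fun p : UX X => R p.1.1 p.1.2) with hE
  have hEm : Measurable E := measurable_extCurve hX hR.1
  obtain ⟨C, hC⟩ := hR.exists_bddCurve hX
  have hCE : ∀ x ∈ X, BddCurve (fun u => E (u, x)) C := fun x hx =>
    ⟨(hEm.comp (f := fun u : ℝ => (u, x)) (by fun_prop)).aemeasurable, fun u hu => by
      have h := extCurve_slice_eqOn (R := R) hx hu
      have hb := (hC x hx).bound u hu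
      simp only at h hb
      rwa [h] at hb⟩
  constructor
  · have h1 : (fun s => smoothU (I.δ s) (rearr R) (I.z s) (I.x s)) = fun s =>
        ∫ u, boxKernel (I.δ s) (I.z s - u) * (fun p : ℝ × Cov d =>
          if p ∈ Ioc (0 : ℝ) 1 ×ˢ X then quantU (fun u => E (u, p.2)) p.1 else 0) (u, I.x s)
            ∂unif := by
      ext s
      change ∫ u, boxKernel (I.δ s) (I.z s - u) * quantU (fun v => R v (I.x s)) u ∂unif = _
      refine integral_congr_ae ?_
      rw [unif_eq_restrict_Ioc]
      filter_upwards [ae_restrict_mem measurableSet_Ioc] with u hu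
      rw [quantU_congr (extCurve_slice_eqOn (R := R) (I.x_mem s))]
      rw [if_pos ⟨hu, I.x_mem s⟩]
    rw [h1]
    refine measurable_integral ((I.measurable_kernel measurable_snd).mul ?_)
    exact (measurable_quantU_uncurry hX hEm hCE).comp (f := fun t : S × ℝ => (t.2, I.x t.1))
      (measurable_snd.prodMk (I.measurable_x.comp measurable_fst))
  · refine ⟨|C|, fun s => abs_smooth_le (I.δ_pos s) (fun u hu => ?_) (abs_nonneg _) _⟩
    have hc := hC (I.x s) (I.x_mem s)
    change |quantU (fun v => R v (I.x s)) u| ≤ |C|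
    rcases eq_or_lt_of_le hu.1 with rfl | hpos
    -- At `u = 0` the infimum is over all of `ℝ`, to which `sInf` assigns the value `0`.
    · have : {y : ℝ | 0 ≤ cdfU (fun v => R v (I.x s)) y} = univ :=
        eq_univ_of_forall hc.cdfU_nonneg
      rw [quantU, this, Real.sInf_univ, abs_zero]
      exact abs_nonneg _
    · exact (hc.abs_quantU_le ⟨hpos, hu.2⟩).trans (le_abs_self _)

/-! ### The limit operators -/

/-- The function `c ∫ k_δ(z - ρ(u, x)) f(u, x) du` on the index set. -/
def kernelFun (ρ : ℝ × Cov d → ℝ) (c : ℝ) (f : UX X → ℝ) (s : S) : ℝ :=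
  c * ∫ u, boxKernel (I.δ s) (I.z s - ρ (u, I.x s)) * extCurve f (u, I.x s) ∂unif

variable {ρ : ℝ × Cov d → ℝ}

theorem integrable_kernel (hX : IsCompact X) (hρ : Measurable ρ) {f : UX X → ℝ} (hf : IsBddMeas f)
    (s : S) : Integrable
      (fun u => boxKernel (I.δ s) (I.z s - ρ (u, I.x s)) * extCurve f (u, I.x s)) unif := by
  obtain ⟨C, hC⟩ := hf.2
  refine integrable_boxKernel_mul (I.δ_pos s)
    (hρ.comp (f := fun u : ℝ => (u, I.x s)) (by fun_prop)).aemeasurable ?_ _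
  refine Integrable.of_bound ((measurable_extCurve hX hf.1).comp
    (f := fun u : ℝ => (u, I.x s)) (by fun_prop)).aestronglyMeasurable C ?_
  filter_upwards [ae_restrict_mem measurableSet_Icc] with u hu
  have h : (u, I.x s) ∈ UX X := ⟨hu, I.x_mem s⟩
  change |extCurve f (u, I.x s)| ≤ C
  rw [extCurve_apply f h]
  exact hC _

/-- The lower bound `I.lo` on the bandwidths bounds all kernels at once. This gives both the
continuity of the operator and, by comparison with `0`, the boundedness of its values. -/
theorem abs_kernelFun_sub_le (hX : IsCompact X) (hρ : Measurable ρ) (c : ℝ) {f g : UX X → ℝ}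
    (hf : IsBddMeas f) (hg : IsBddMeas g) {D : ℝ} (hD : ∀ t, |f t - g t| ≤ D) (s : S) :
    |I.kernelFun ρ c f s - I.kernelFun ρ c g s| ≤ |c| * (1 / (2 * I.lo) * D) := by
  rw [kernelFun, kernelFun, ← mul_sub, abs_mul,
    ← integral_sub (I.integrable_kernel hX hρ hf s) (I.integrable_kernel hX hρ hg s)]
  refine mul_le_mul_of_nonneg_left ?_ (abs_nonneg c)
  have h := norm_integral_le_of_norm_le_const (μ := unif) (C := 1 / (2 * I.lo) * D)
    (f := fun u => boxKernel (I.δ s) (I.z s - ρ (u, I.x s)) * extCurve f (u, I.x s) -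
      boxKernel (I.δ s) (I.z s - ρ (u, I.x s)) * extCurve g (u, I.x s)) ?_
  · rwa [probReal_univ, mul_one, Real.norm_eq_abs] at h
  filter_upwards [ae_restrict_mem measurableSet_Icc] with u hu
  have hm : (u, I.x s) ∈ UX X := ⟨hu, I.x_mem s⟩
  rw [← mul_sub, Real.norm_eq_abs, abs_mul, extCurve_apply f hm, extCurve_apply g hm]
  have hlo := I.lo_pos
  refine mul_le_mul ((abs_boxKernel_le (I.δ_pos s) _).trans ?_) (hD _) (abs_nonneg _)
    (by positivity)
  exact one_div_le_one_div_of_le (by positivity) (by linarith [I.lo_le s])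

theorem isBddMeas_kernelFun (hX : IsCompact X) (hρ : Measurable ρ) (c : ℝ) {f : UX X → ℝ}
    (hf : IsBddMeas f) : IsBddMeas (I.kernelFun ρ c f) := by
  constructor
  · refine (measurable_integral ((I.measurable_kernel (r := fun t => ρ (t.2, I.x t.1)) ?_).mul
      ?_)).const_mul c
    · exact hρ.comp (measurable_snd.prodMk (I.measurable_x.comp measurable_fst))
    · exact (measurable_extCurve hX hf.1).comp
        (measurable_snd.prodMk (I.measurable_x.comp measurable_fst))
  · obtain ⟨C, hC⟩ := hf.2
    have h0 : IsBddMeas fun _ : UX X => (0 : ℝ) := ⟨measurable_const, 0, fun _ => by simp⟩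
    refine ⟨|c| * (1 / (2 * I.lo) * C), fun s => ?_⟩
    have h := I.abs_kernelFun_sub_le hX hρ c hf h0 (D := C) (by simpa using hC) s
    have hz : I.kernelFun ρ c (fun _ : UX X => (0 : ℝ)) s = 0 := by
      have : extCurve (fun _ : UX X => (0 : ℝ)) = 0 := by
        ext p
        by_cases hp : p ∈ UX X
        · exact extCurve_apply _ hp
        · exact Function.extend_apply' _ _ _ fun ⟨a, ha⟩ => hp (ha ▸ a.2)
      simp [kernelFun, this]
    rwa [hz, sub_zero] at h

theorem isBddMeas_coe {T : Type*} [MeasurableSpace T] (f : EllInf T) : IsBddMeas fun t => f.1 t :=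
  ⟨f.2, _, f.abs_le⟩

/-- The operator `f ↦ c ∫ k_δ(z - ρ(u, x)) f(u, x) du` on `ℓ^∞`. -/
def kernelOp (hX : IsCompact X) (hρ : Measurable ρ) (c : ℝ) (f : EllInf (UX X)) : EllInf S :=
  (I.isBddMeas_kernelFun hX hρ c (isBddMeas_coe f)).toEllInf

theorem continuous_kernelOp (hX : IsCompact X) (hρ : Measurable ρ) (c : ℝ) :
    Continuous (I.kernelOp hX hρ c) := by
  have hlo := I.lo_pos
  refine (LipschitzWith.of_dist_le_mul (K := ⟨|c| * (1 / (2 * I.lo)), by positivity⟩)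
    fun f g => ?_).continuous
  refine EllInf.dist_le (mul_nonneg (NNReal.coe_nonneg _) dist_nonneg) fun s => ?_
  have := I.abs_kernelFun_sub_le hX hρ c (isBddMeas_coe f) (isBddMeas_coe g) (f.abs_sub_le g) s
  rw [← mul_assoc] at this
  exact this

end SmoothIndex

/-! ### Convergence of the smoothed processes. -/

section Limits

variable {S : Type*} [MeasurableSpace S] (I : SmoothIndex X S)
  {Ω : ℕ → Type*} [∀ n, MeasurableSpace (Ω n)] {P : ∀ n, Measure (Ω n)}
  [∀ n, IsProbabilityMeasure (P n)]
  {Ω' : Type*} [MeasurableSpace Ω'] {P' : Measure Ω'} [IsProbabilityMeasure P']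
  {Q : ℝ → Cov d → ℝ} {Qhat : ∀ n, Ω n → ℝ → Cov d → ℝ} {a : ℕ → ℝ} {G : Ω' → ℝ → Cov d → ℝ}

/-- The delta method for a smoothed functional `Ψ` of the curve whose expansion around `Q` is given
by a kernel operator, with a remainder controlled by the mass of tubes around level sets. -/
theorem ConvInLaw.of_kernel_expansion (hX : IsCompact X)
    (hQ : ContinuousOn (fun p : ℝ × Cov d => Q p.1 p.2) (UX X))
    (htame : ∀ x ∈ X, TameCurve fun u => Q u x)
    (hQhat : ∀ n ω, IsBddMeas fun p : UX X => Qhat n ω p.1.1 p.1.2)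
    (ha : Tendsto a atTop atTop)
    (hconv : ConvInLaw (T := UX X) P P'
      (fun n ω p => a n * (Qhat n ω p.1.1 p.1.2 - Q p.1.1 p.1.2)) (fun ω p => G ω p.1.1 p.1.2))
    {Ψ : (ℝ → Cov d → ℝ) → S → ℝ}
    (hΨ : ∀ R : ℝ → Cov d → ℝ, IsBddMeas (fun p : UX X => R p.1.1 p.1.2) → IsBddMeas (Ψ R))
    {ρ : ℝ × Cov d → ℝ} (hρ : Measurable ρ) (c : ℝ)
    (hexp : ∀ R : ℝ → Cov d → ℝ, IsBddMeas (fun p : UX X => R p.1.1 p.1.2) → ∀ (ε w : ℝ) (s : S),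
      (∀ u ∈ Icc (0 : ℝ) 1, |R u (I.x s) - Q u (I.x s)| ≤ ε) →
      (∀ y, unif.real {u | |Q u (I.x s) - y| ≤ ε} ≤ w) →
      |Ψ R s - Ψ Q s - c * ∫ u, boxKernel (I.δ s) (I.z s - ρ (u, I.x s)) *
        (R u (I.x s) - Q u (I.x s)) ∂unif| ≤ 2 * (ε * w) / I.δ s)
    {Wlim : Ω' → S → ℝ}
    (hlim : ∀ ω s, Wlim ω s = c * ∫ u, boxKernel (I.δ s) (I.z s - ρ (u, I.x s)) *
      G ω u (I.x s) ∂unif) :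
    ConvInLaw P P' (fun n ω s => a n * (Ψ (Qhat n ω) s - Ψ Q s)) Wlim := by
  have hQb : IsBddMeas fun p : UX X => Q p.1.1 p.1.2 := by
    obtain ⟨M, hM⟩ := (isCompact_Icc.prod hX : IsCompact (UX X)).exists_bound_of_continuousOn hQ
    exact ⟨(continuousOn_iff_continuous_domRestrict.1 hQ).measurable, M, fun p => hM p.1 p.2⟩
  have hker : ∀ (R : ℝ → Cov d → ℝ) (s : S), I.kernelFun ρ c (fun p : UX X => R p.1.1 p.1.2) s =
      c * ∫ u, boxKernel (I.δ s) (I.z s - ρ (u, I.x s)) * R u (I.x s) ∂unif := by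
    intro R s
    rw [SmoothIndex.kernelFun]
    congr 1
    refine setIntegral_congr_fun measurableSet_Icc fun u hu => ?_
    have := extCurve_slice_eqOn (R := R) (I.x_mem s) hu
    simp only at this ⊢
    rw [this]
  refine hconv.delta (I.continuous_kernelOp hX hρ c)
    (fun n ω => ((hΨ _ (hQhat n ω)).sub (hΨ _ hQb)).const_mul (a n)) (fun ω s => ?_)
    fun M η hη => ?_
  · rw [hlim]
    exact (hker (G ω) s).symm
  · set M' : ℝ := max M 0 + 1 with hM'
    have hM'pos : 0 < M' := by positivity
    have hlo := I.lo_pos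
    -- The tube mass is chosen so that `a n * 2 * (M' / a n) * (η * I.lo / (2 * M')) / δ = η * I.lo
    -- / δ ≤ η`; the factors `a n` cancel.
    obtain ⟨ε₀, hε₀, htube⟩ := exists_uniform_tube hX hQ
      (fun x hx => (htame x hx).unif_level_eq_zero) (η := η * I.lo / (2 * M')) (by positivity)
    filter_upwards [ha.eventually_ge_atTop (M' / ε₀), ha.eventually_gt_atTop 0] with n hn hpos ω hZ s
    have hεle : M' / a n ≤ ε₀ := by
      rw [div_le_iff₀ hε₀] at hn
      rw [div_le_iff₀ hpos]
      linarith
    have hdiff : ∀ u ∈ Icc (0 : ℝ) 1, |Qhat n ω u (I.x s) - Q u (I.x s)| ≤ M' / a n := by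
      intro u hu
      have h1 := hZ ⟨(u, I.x s), hu, I.x_mem s⟩
      simp only [abs_mul, abs_of_pos hpos] at h1
      rw [le_div_iff₀ hpos, mul_comm]
      have : M ≤ max M 0 := le_max_left _ _
      linarith
    have h2 := hexp _ (hQhat n ω) _ _ s hdiff (htube _ hεle (I.x s) (I.x_mem s))
    have h3 : (I.kernelOp hX hρ c (hconv.mem n ω).toEllInf).1 s = a n * (c * ∫ u,
        boxKernel (I.δ s) (I.z s - ρ (u, I.x s)) *
          (Qhat n ω u (I.x s) - Q u (I.x s)) ∂unif) := by
      have h4 := hker (fun u x => a n * (Qhat n ω u x - Q u x)) s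
      refine h4.trans ?_
      simp only [mul_left_comm _ (a n)]
      rw [integral_const_mul]
      ring
    rw [h3, ← mul_sub, abs_mul, abs_of_pos hpos]
    have hδ := I.δ_pos s
    calc _ ≤ a n * (2 * (M' / a n * (η * I.lo / (2 * M'))) / I.δ s) :=
          mul_le_mul_of_nonneg_left h2 hpos.le
      _ = η * (I.lo / I.δ s) := by field_simp
      _ ≤ η * 1 := by
          refine mul_le_mul_of_nonneg_left ?_ hη.le
          rw [div_le_one hδ]
          exact I.lo_le s
      _ = η := mul_one η

theorem dens_eq_rootSum (Q : ℝ → Cov d → ℝ) (y : ℝ) (x : Cov d) :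
    dens Q y x = rootSum (fun u => Q u x) (fun _ => 1) y := by
  by_cases h : IsRegularValue Q y x
  · rw [dens, if_pos h]
    exact (if_pos h).symm
  · rw [dens, if_neg h]
    exact (if_neg h).symm

theorem derivF_eq_neg_rootSum (Q h : ℝ → Cov d → ℝ) (y : ℝ) (x : Cov d) :
    derivF Q h y x = -rootSum (fun u => Q u x) (fun u => h u x) y := by
  by_cases hy : IsRegularValue Q y x
  · rw [derivF, if_pos hy]
    exact congrArg Neg.neg (if_pos hy).symm
  · rw [derivF, if_neg hy, ← neg_zero]
    exact congrArg Neg.neg (if_neg hy).symm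

/-- Convergence of the smoothed empirical distribution functions. -/
theorem ConvInLaw.smoothY (hX : IsCompact X)
    (hQ : ContinuousOn (fun p : ℝ × Cov d => Q p.1 p.2) (UX X))
    (htame : ∀ x ∈ X, TameCurve fun u => Q u x)
    (hQhat : ∀ n ω, IsBddMeas fun p : UX X => Qhat n ω p.1.1 p.1.2)
    (ha : Tendsto a atTop atTop)
    (hG : ∀ ω, ContinuousOn (fun p : ℝ × Cov d => G ω p.1 p.2) (UX X))
    (hconv : ConvInLaw (T := UX X) P P'
      (fun n ω p => a n * (Qhat n ω p.1.1 p.1.2 - Q p.1.1 p.1.2)) (fun ω p => G ω p.1.1 p.1.2)) :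
    ConvInLaw P P'
      (fun n ω s => a n * (Rearrangement.smoothY (I.δ s) (distr (Qhat n ω)) (I.z s) (I.x s) -
        Rearrangement.smoothY (I.δ s) (distr Q) (I.z s) (I.x s)))
      (fun ω s => Rearrangement.smoothY (I.δ s) (derivF Q (G ω)) (I.z s) (I.x s)) := by
  have hUX : IsCompact (UX X) := isCompact_Icc.prod hX
  obtain ⟨M, hM⟩ := hUX.exists_bound_of_continuousOn hQ
  have hQb : IsBddMeas fun p : UX X => Q p.1.1 p.1.2 :=
    ⟨(continuousOn_iff_continuous_domRestrict.1 hQ).measurable, M, fun p => hM p.1 p.2⟩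
  obtain ⟨C, hC⟩ := hQb.exists_bddCurve hX
  have hE : ∀ s, ∀ u ∈ Icc (0 : ℝ) 1,
      extCurve (fun p : UX X => Q p.1.1 p.1.2) (u, I.x s) = Q u (I.x s) := fun s u hu =>
    (extCurve_slice_eqOn (I.x_mem s) hu).symm
  have hcongr : ∀ (s : S) (h : ℝ → ℝ), ∫ u, boxKernel (I.δ s)
      (I.z s - extCurve (fun p : UX X => Q p.1.1 p.1.2) (u, I.x s)) * h u ∂unif =
      ∫ u, boxKernel (I.δ s) (I.z s - Q u (I.x s)) * h u ∂unif := fun s h => by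
    refine setIntegral_congr_fun measurableSet_Icc fun u hu => ?_
    rw [hE s u hu]
  -- The kernel is evaluated along the curve `Q` itself, with sign `-1`: raising the curve lowers
  -- its distribution function.
  refine ConvInLaw.of_kernel_expansion I hX hQ htame hQhat ha hconv
    (Ψ := fun R s => Rearrangement.smoothY (I.δ s) (distr R) (I.z s) (I.x s))
    (fun R hR => I.isBddMeas_smoothY hX hR) (measurable_extCurve hX hQb.1) (-1) ?_ ?_
  · intro R hR ε w s hε hw
    obtain ⟨D, hD⟩ := hR.exists_bddCurve hX
    have hx := I.x_mem s
    have hδ := I.δ_pos s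
    rw [hcongr s (fun u => R u (I.x s) - Q u (I.x s)), neg_one_mul]
    refine ((hC _ hx).abs_smooth_cdfU_sub_le (hD _ hx) (htame _ hx).unif_level_eq_zero hε hw hδ
      (I.z s)).trans ?_
    have h0 : 0 ≤ ε := (abs_nonneg _).trans (hε 0 ⟨le_rfl, zero_le_one⟩)
    have w0 : 0 ≤ ε * w := mul_nonneg h0 (measureReal_nonneg.trans (hw 0))
    exact div_le_div_of_nonneg_right (by linarith) hδ.le
  · intro ω s
    have hx := I.x_mem s
    have hGi : Integrable (fun u => G ω u (I.x s)) unif :=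
      ((hG ω).comp (f := fun u : ℝ => (u, I.x s)) (by fun_prop)
        (fun u hu => ⟨hu, hx⟩)).integrableOn_compact isCompact_Icc
    rw [hcongr s (fun u => G ω u (I.x s)), neg_one_mul,
      ← (htame _ hx).smooth_neg_rootSum hGi (I.δ_pos s), Rearrangement.smoothY]
    simp only [derivF_eq_neg_rootSum]

/-- Convergence of the smoothed empirical rearranged curves. -/
theorem ConvInLaw.smoothU (hX : IsCompact X)
    (hQ : ContinuousOn (fun p : ℝ × Cov d => Q p.1 p.2) (UX X))
    (htame : ∀ x ∈ X, TameCurve fun u => Q u x)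
    (hQhat : ∀ n ω, IsBddMeas fun p : UX X => Qhat n ω p.1.1 p.1.2)
    (ha : Tendsto a atTop atTop)
    (hG : ∀ ω, ContinuousOn (fun p : ℝ × Cov d => G ω p.1 p.2) (UX X))
    (hconv : ConvInLaw (T := UX X) P P'
      (fun n ω p => a n * (Qhat n ω p.1.1 p.1.2 - Q p.1.1 p.1.2)) (fun ω p => G ω p.1.1 p.1.2))
    (hI : ∀ s, I.z s ∈ Icc (0 : ℝ) 1) :
    ConvInLaw P P'
      (fun n ω s => a n * (Rearrangement.smoothU (I.δ s) (rearr (Qhat n ω)) (I.z s) (I.x s) -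
        Rearrangement.smoothU (I.δ s) (rearr Q) (I.z s) (I.x s)))
      (fun ω s => Rearrangement.smoothU (I.δ s) (derivQ Q (G ω)) (I.z s) (I.x s)) := by
  have hUX : IsCompact (UX X) := isCompact_Icc.prod hX
  obtain ⟨M, hM⟩ := hUX.exists_bound_of_continuousOn hQ
  have hQb : IsBddMeas fun p : UX X => Q p.1.1 p.1.2 :=
    ⟨(continuousOn_iff_continuous_domRestrict.1 hQ).measurable, M, fun p => hM p.1 p.2⟩
  obtain ⟨C, hC⟩ := hQb.exists_bddCurve hX
  set E := extCurve fun p : UX X => Q p.1.1 p.1.2 with hEdef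
  have hEm : Measurable E := measurable_extCurve hX hQb.1
  have hρ : Measurable fun p : ℝ × Cov d => cdfU (fun u => E (u, p.2)) (E p) :=
    (measurable_cdfU_uncurry hEm).comp (f := fun p : ℝ × Cov d => (E p, p.2))
      (hEm.prodMk measurable_snd)
  have hcongr : ∀ (s : S) (h : ℝ → ℝ), ∫ u, boxKernel (I.δ s)
      (I.z s - cdfU (fun v => E (v, I.x s)) (E (u, I.x s))) * h u ∂unif =
      ∫ u, boxKernel (I.δ s) (I.z s - cdfU (fun v => Q v (I.x s)) (Q u (I.x s))) * h u ∂unif :=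
    fun s h => by
    refine setIntegral_congr_fun measurableSet_Icc fun u hu => ?_
    have h1 := extCurve_slice_eqOn (R := Q) (I.x_mem s)
    have h2 : E (u, I.x s) = Q u (I.x s) := (h1 hu).symm
    rw [h2, cdfU_congr h1]
  -- The kernel is now evaluated along `F(Q(u|x)|x)`, the rank of `Q(u|x)`, with sign `+1`.
  refine ConvInLaw.of_kernel_expansion I hX hQ htame hQhat ha hconv
    (Ψ := fun R s => Rearrangement.smoothU (I.δ s) (rearr R) (I.z s) (I.x s))
    (fun R hR => I.isBddMeas_smoothU hX hR) hρ 1 ?_ ?_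
  · intro R hR ε w s hε hw
    obtain ⟨D, hD⟩ := hR.exists_bddCurve hX
    have hx := I.x_mem s
    rw [hcongr s (fun u => R u (I.x s) - Q u (I.x s)), one_mul]
    exact (hC _ hx).abs_smooth_quantU_sub_le (hD _ hx) (htame _ hx).unif_level_eq_zero hε hw
      (I.δ_pos s) (hI s)
  · intro ω s
    have hx := I.x_mem s
    have hGi : Integrable (fun u => G ω u (I.x s)) unif :=
      ((hG ω).comp (f := fun u : ℝ => (u, I.x s)) (by fun_prop)
        (fun u hu => ⟨hu, hx⟩)).integrableOn_compact isCompact_Icc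
    rw [hcongr s (fun u => G ω u (I.x s)), one_mul,
      ← (htame _ hx).smooth_rootSum_div_quantU (hC _ hx) hGi (I.δ_pos s), Rearrangement.smoothU]
    congr 1
    ext u
    rw [derivQ, derivF_eq_neg_rootSum, neg_mul_neg, dens_eq_rootSum]
    rfl

end Limits

/-! ### Tame slices, concrete index sets and the conclusion. -/

theorem tameCurve_slice {Q : ℝ → Cov d → ℝ}
    (hQ : ContDiffOn ℝ 1 (fun p : ℝ × Cov d => Q p.1 p.2) (UX X))
    (hcrit : ∃ N : ℕ, ∀ x ∈ X,
      {u : ℝ | u ∈ Icc (0 : ℝ) 1 ∧ partialU Q u x = 0}.encard ≤ N) {x : Cov d} (hx : x ∈ X) :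
    TameCurve fun u => Q u x := by
  obtain ⟨N, hN⟩ := hcrit
  refine ⟨?_, Set.finite_of_encard_le_coe (hN x hx)⟩
  exact (hQ.differentiableOn one_ne_zero).comp (f := fun u : ℝ => (u, x))
    (by fun_prop) (fun u hu => ⟨hu, hx⟩)

/-- Evaluation points in `A` and bandwidths in `[δ₁, δ₂]`. -/
def prodIndex {A : Set (ℝ × Cov d)} (hA : ∀ p ∈ A, p.2 ∈ X) {δ₁ δ₂ : ℝ} (h : 0 < δ₁) :
    SmoothIndex X (A × Icc δ₁ δ₂) where
  z s := s.1.1.1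
  x s := s.1.1.2
  δ s := s.2
  lo := δ₁
  measurable_z := by fun_prop
  measurable_x := by fun_prop
  measurable_δ := by fun_prop
  x_mem s := hA _ s.1.2
  lo_pos := h
  lo_le s := s.2.2.1

/-- Evaluation points in `A` and a fixed bandwidth. -/
def constIndex {A : Set (ℝ × Cov d)} (hA : ∀ p ∈ A, p.2 ∈ X) {δ : ℝ} (h : 0 < δ) :
    SmoothIndex X A where
  z s := s.1.1
  x s := s.1.2
  δ _ := δ
  lo := δ
  measurable_z := by fun_prop
  measurable_x := by fun_prop
  measurable_δ := measurable_const
  x_mem s := hA _ s.2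
  lo_pos := h
  lo_le _ := le_rfl

end Rearrangement

end

theorem corollary4 {d : ℕ} (X : Set (Rearrangement.Cov d)) (hX : IsCompact X)
    -- the population curve
    (Q : ℝ → Rearrangement.Cov d → ℝ)
    (hQ : ContDiffOn ℝ 1 (fun p : ℝ × Rearrangement.Cov d => Q p.1 p.2) (Rearrangement.UX X))
    (hcrit : ∃ N : ℕ, ∀ x ∈ X,
      {u : ℝ | u ∈ Icc (0 : ℝ) 1 ∧ Rearrangement.partialU Q u x = 0}.encard ≤ N)
    -- the estimators and the limit process
    {Ω : ℕ → Type*} [∀ n, MeasurableSpace (Ω n)] (P : ∀ n, Measure (Ω n))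
    [∀ n, IsProbabilityMeasure (P n)]
    {Ω' : Type*} [MeasurableSpace Ω'] (P' : Measure Ω') [IsProbabilityMeasure P']
    (Qhat : ∀ n, Ω n → ℝ → Rearrangement.Cov d → ℝ)
    (hQhat : ∀ n ω, Rearrangement.IsBddMeas
      (fun p : Rearrangement.UX X => Qhat n ω p.1.1 p.1.2))
    (a : ℕ → ℝ) (ha : Tendsto a atTop atTop)
    (G : Ω' → ℝ → Rearrangement.Cov d → ℝ)
    (hG : ∀ ω, ContinuousOn (fun p : ℝ × Rearrangement.Cov d => G ω p.1 p.2)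
      (Rearrangement.UX X))
    (hconv : Rearrangement.ConvInLaw (T := Rearrangement.UX X) P P'
      (fun n ω p => a n * (Qhat n ω p.1.1 p.1.2 - Q p.1.1 p.1.2))
      (fun ω p => G ω p.1.1 p.1.2)) :
    -- for each fixed bandwidth, in `ℓ^∞(YX)` and in `ℓ^∞(UX)`
    (∀ δ : ℝ, 0 < δ →
      Rearrangement.ConvInLaw (T := Rearrangement.YX Q X) P P'
        (fun n ω p => a n *
          (Rearrangement.smoothY δ (Rearrangement.distr (Qhat n ω)) p.1.1 p.1.2
            - Rearrangement.smoothY δ (Rearrangement.distr Q) p.1.1 p.1.2))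
        (fun ω p => Rearrangement.smoothY δ (Rearrangement.derivF Q (G ω)) p.1.1 p.1.2) ∧
      Rearrangement.ConvInLaw (T := Rearrangement.UX X) P P'
        (fun n ω p => a n *
          (Rearrangement.smoothU δ (Rearrangement.rearr (Qhat n ω)) p.1.1 p.1.2
            - Rearrangement.smoothU δ (Rearrangement.rearr Q) p.1.1 p.1.2))
        (fun ω p => Rearrangement.smoothU δ (Rearrangement.derivQ Q (G ω)) p.1.1 p.1.2)) ∧
    -- uniformly in the bandwidth: as processes indexed also by `δ ∈ [δ₁, δ₂]`
    (∀ δ₁ δ₂ : ℝ, 0 < δ₁ → δ₁ ≤ δ₂ →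
      Rearrangement.ConvInLaw (T := Rearrangement.YX Q X × Icc δ₁ δ₂) P P'
        (fun n ω q => a n *
          (Rearrangement.smoothY q.2 (Rearrangement.distr (Qhat n ω)) q.1.1.1 q.1.1.2
            - Rearrangement.smoothY q.2 (Rearrangement.distr Q) q.1.1.1 q.1.1.2))
        (fun ω q => Rearrangement.smoothY q.2 (Rearrangement.derivF Q (G ω)) q.1.1.1 q.1.1.2) ∧
      Rearrangement.ConvInLaw (T := Rearrangement.UX X × Icc δ₁ δ₂) P P'
        (fun n ω q => a n *
          (Rearrangement.smoothU q.2 (Rearrangement.rearr (Qhat n ω)) q.1.1.1 q.1.1.2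
            - Rearrangement.smoothU q.2 (Rearrangement.rearr Q) q.1.1.1 q.1.1.2))
        (fun ω q => Rearrangement.smoothU q.2 (Rearrangement.derivQ Q (G ω)) q.1.1.1 q.1.1.2)) :=
  by
  have hQc := hQ.continuousOn
  have htame := fun x (hx : x ∈ X) => Rearrangement.tameCurve_slice hQ hcrit hx
  have hYX : ∀ p ∈ Rearrangement.YX Q X, p.2 ∈ X := fun p hp => hp.1
  have hUX : ∀ p ∈ Rearrangement.UX X, p.2 ∈ X := fun p hp => hp.2
  refine ⟨fun δ hδ => ⟨?_, ?_⟩, fun δ₁ δ₂ hδ _ => ⟨?_, ?_⟩⟩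
  · exact .smoothY (Rearrangement.constIndex hYX hδ) hX hQc htame hQhat ha hG hconv
  · exact .smoothU (Rearrangement.constIndex hUX hδ) hX hQc htame hQhat ha hG hconv
      fun s => s.2.1
  · exact .smoothY (Rearrangement.prodIndex hYX hδ) hX hQc htame hQhat ha hG hconv
  · exact .smoothU (Rearrangement.prodIndex hUX hδ) hX hQc htame hQhat ha hG hconv
      fun s => s.1.2.1
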